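/- **Theorem 1.3.** Let $(\mathcal C,\otimes,I,C)$ be a braided tensor category (with associativity and unit constraints suppressed from the notation) in which every pair of parallel morphisms has an equaliser and a coequaliser. Let $A$ and $B$ be algebras in $\mathcal C$ and let $H$ be a Hopf algebra in $\mathcal C$. Write an object for its identity morphism, $m,\eta,\Delta,\epsilon$ for multiplications, units, comultiplication and counit, and let $H\otimes H$ carry the comultiplication $(H\otimes C_{H,H}\otimes H)(\Delta\otimes\Delta)$. *Crossed products.* For $\alpha:H\otimes B\to B$ and $\sigma:H\otimes H\to B$ put $\hat\sigma=(\sigma\otimes m_H)(H\otimes C_{H,H}\otimes H)(\Delta\otimes\Delta):H\otimes H\to B\otimes H$. The morphism $\alpha$ is a *weak action* if $\alpha(H\otimes m_B)=m_B(\alpha\otimes\alpha)(H\otimes C_{H,B}\otimes B)(\Delta\otimes B\otimes B)$ and $\alpha(H\otimes\eta_B)=\eta_B\epsilon$. The morphism $\sigma$ is a *2-cocycle* (with respect to $\alpha$) if $m_B(\alpha\otimes\sigma)(H\otimes C_{H,B}\otimes H)(\Delta\otimes\hat\sigma)=m_B(B\otimes\sigma)(\hat\sigma\otimes H)$ and $\sigma(H\otimes\eta_H)=\sigma(\eta_H\otimes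 H)=\eta_B\epsilon$; it is *invertible* if it has a two-sided inverse for the convolution product $f*g=m_B(f\otimes g)\Delta_{H\otimes H}$, whose unit is $\eta_B(\epsilon\otimes\epsilon)$. The crossed product $B\#_\sigma H$ is the object $B\otimes H$ with the unit $\eta_B\otimes\eta_H$ and the multiplication $$(m_B\otimes H)(m_B\otimes\hat\sigma)(B\otimes\alpha\otimes H\otimes H)(B\otimes H\otimes C_{H,B}\otimes H)(B\otimes\Delta\otimes B\otimes H).$$ It is a *crossed product algebra with weak action $\alpha$ and invertible 2-cocycle $\sigma$* if $\alpha$ is a weak action, $\sigma$ is an invertible 2-cocycle, and this multiplication is associative with this unit. *Four conditions.* For morphisms $\psi:A\to A\otimes H$ and $p:B\to A$ consider: 1. $(A,\psi)$ is a right $H$-comodule algebra, i.e. $\psi$ is a coassociative counital coaction and a morphism of algebras into $A\otimes H$ with multiplication $(m_A\otimes m_H)(A\otimes C_{H,A}\otimes H)$; and $B=A^{coH}$ via $p$, i.e. $p$ is a morphism of algebras and an equaliser of $\psi$ and $A\otimes\eta_H$. 2. The extension $A/B$ is $H$-Galois: if $q:A\otimes A\to A\otimes_BA$ denotes the coequaliser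 of $(m_A\otimes A)(A\otimes p\otimes A)$ and $(A\otimes m_A)(A\otimes p\otimes A)$, there is an isomorphism $can:A\otimes_BA\to A\otimes H$ with $can\circ q=(m_A\otimes H)(A\otimes\psi)$. 3. $q$ is a split epimorphism. 4. There is an isomorphism $B\otimes H\cong A$ of left $B$-modules and right $H$-comodules, where $B\otimes H$ has the $B$-action $m_B\otimes H$ and the coaction $B\otimes\Delta$, and $A$ has the $B$-action $m_A(p\otimes A)$ and the coaction $\psi$. Then: (a) $A$ is isomorphic, as an algebra, to a crossed product algebra $B\#_\sigma H$ with some weak action $\alpha$ and some invertible 2-cocycle $\sigma$ if and only if there are $\psi:A\to A\otimes H$ and $p:B\to A$ satisfying conditions 1–4. (b) More precisely, for any given morphisms $\psi:A\to A\otimes H$ and $p:B\to A$, there are a crossed product algebra $B\#_\sigma H$ with weak action $\alpha$ and invertible 2-cocycle $\sigma$ and an isomorphism of algebras $B\#_\sigma H\cong A$ that carries $B\otimes\Delta$ to $\psi$ and $B\otimes\eta_H$ to $p$ if and only if $\psi$ and $p$ satisfy conditions 1–4. -/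

import Mathlib

open CategoryTheory MonoidalCategory Limits
open scoped MonObj ComonObj

namespace BraidedGalois

universe v u

variable {C : Type u} [Category.{v} C] [MonoidalCategory C] [BraidedCategory C]

/-! ### Comodule algebras, coinvariants and Galois extensions -/

/-- `ψ : A ⟶ A ⊗ H` makes the algebra `A` into a right `H`-comodule algebra: it is a coassociative
counital coaction and a morphism of algebras, where `A ⊗ H` carries the braided tensor product
algebra structure. -/
structure IsComoduleAlgebra {A H : C} [MonObj A] [HopfObj H] (ψ : A ⟶ A ⊗ H) : Prop where
  coassoc : ψ ≫ ψ ▷ H ≫ (α_ A H H).hom = ψ ≫ A ◁ Δ[H]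
  counit : ψ ≫ A ◁ ε[H] = (ρ_ A).inv
  isMonHom : IsMonHom ψ

/-- The trivial coaction `A ⊗ η : A ⟶ A ⊗ H`. -/
def trivialCoaction (A H : C) [HopfObj H] : A ⟶ A ⊗ H :=
  (ρ_ A).inv ≫ A ◁ η[H]

/-- `p : B ⟶ A` exhibits the algebra `B` as the coinvariants of `(A, ψ)`: it is a morphism of
algebras and an equalizer of `ψ` and `A ⊗ η`. -/
structure IsCoinvariants {A B H : C} [MonObj A] [MonObj B] [HopfObj H]
    (ψ : A ⟶ A ⊗ H) (p : B ⟶ A) : Prop where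
  isMonHom : IsMonHom p
  isEqualizer : ∃ w : p ≫ ψ = p ≫ trivialCoaction A H, Nonempty (IsLimit (Fork.ofι p w))

/-- The morphism `A ⊗ B ⊗ A ⟶ A ⊗ A` through which `B` acts (along `p`) on the left factor. -/
def actOnLeftFactor {A B : C} [MonObj A] (p : B ⟶ A) : A ⊗ (B ⊗ A) ⟶ A ⊗ A :=
  A ◁ p ▷ A ≫ (α_ A A A).inv ≫ μ[A] ▷ A

/-- The morphism `A ⊗ B ⊗ A ⟶ A ⊗ A` through which `B` acts (along `p`) on the right factor. -/
def actOnRightFactor {A B : C} [MonObj A] (p : B ⟶ A) : A ⊗ (B ⊗ A) ⟶ A ⊗ A :=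
  A ◁ p ▷ A ≫ A ◁ μ[A]

/-- The tensor product `A ⊗_B A` over `B`, where `B` acts on `A` along `p : B ⟶ A`. -/
noncomputable def tensorOver [HasCoequalizers C] {A B : C} [MonObj A] (p : B ⟶ A) : C :=
  coequalizer (actOnLeftFactor p) (actOnRightFactor p)

/-- The canonical epimorphism `q : A ⊗ A ⟶ A ⊗_B A`. -/
noncomputable def toTensorOver [HasCoequalizers C] {A B : C} [MonObj A] (p : B ⟶ A) :
    A ⊗ A ⟶ tensorOver p :=
  coequalizer.π (actOnLeftFactor p) (actOnRightFactor p)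

/-- The morphism `can' = (m ⊗ H) (A ⊗ ψ) : A ⊗ A ⟶ A ⊗ H`. -/
def canPrime {A H : C} [MonObj A] (ψ : A ⟶ A ⊗ H) : A ⊗ A ⟶ A ⊗ H :=
  A ◁ ψ ≫ (α_ A A H).inv ≫ μ[A] ▷ H

/-- The extension given by `p` is `H`-Galois: `can'` factors through `q` by an isomorphism
`can : A ⊗_B A ≅ A ⊗ H`. -/
def IsGalois [HasCoequalizers C] {A B H : C} [MonObj A] (ψ : A ⟶ A ⊗ H) (p : B ⟶ A) : Prop :=
  ∃ can : tensorOver p ≅ A ⊗ H, toTensorOver p ≫ can.hom = canPrime ψ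

/-- `A` is isomorphic to `B ⊗ H` as a left `B`-module and right `H`-comodule; here `B` acts on `A`
along `p` and on `B ⊗ H` by `m ⊗ H`, and `H` coacts on `A` by `ψ` and on `B ⊗ H` by `B ⊗ Δ`. -/
def HasNormalBasis {A B H : C} [MonObj A] [MonObj B] [HopfObj H]
    (ψ : A ⟶ A ⊗ H) (p : B ⟶ A) : Prop :=
  ∃ Φ : B ⊗ H ≅ A,
    B ◁ Φ.hom ≫ p ▷ A ≫ μ[A] = (α_ B B H).inv ≫ μ[B] ▷ H ≫ Φ.hom ∧
    Φ.hom ≫ ψ = B ◁ Δ[H] ≫ (α_ B H H).inv ≫ Φ.hom ▷ H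

/-- The four conditions on a coaction `ψ` of `H` on `A` and a morphism `p : B ⟶ A`. -/
structure IsSplitGaloisWithNormalBasis [HasCoequalizers C] {A B H : C} [MonObj A] [MonObj B]
    [HopfObj H] (ψ : A ⟶ A ⊗ H) (p : B ⟶ A) : Prop where
  comoduleAlgebra : IsComoduleAlgebra ψ
  coinvariants : IsCoinvariants ψ p
  galois : IsGalois ψ p
  split : IsSplitEpi (toTensorOver p)
  normalBasis : HasNormalBasis ψ p

/-! ### Crossed products -/

section CrossedProduct

variable {B H : C} [MonObj B] [HopfObj H]

/-- `H` acts weakly on the algebra `B` by `act : H ⊗ B ⟶ B`; on elements,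
`h · (b b') = (h₁ · b) (h₂ · b')` and `h · 1 = ε(h) 1`. -/
structure IsWeakAction (act : H ⊗ B ⟶ B) : Prop where
  act_mul : H ◁ μ[B] ≫ act = Δ[H] ▷ (B ⊗ B) ≫ tensorμ H H B B ≫ (act ⊗ₘ act) ≫ μ[B]
  act_one : H ◁ η[B] ≫ act = (ρ_ H).hom ≫ ε[H] ≫ η[B]

/-- The morphism `(σ ⊗ m) (H ⊗ C ⊗ H) (Δ ⊗ Δ) : H ⊗ H ⟶ B ⊗ H`; on elements,
`h ⊗ k ↦ σ(h₁, k₁) ⊗ h₂ k₂`. -/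
def cocycleHat (σ : H ⊗ H ⟶ B) : H ⊗ H ⟶ B ⊗ H :=
  (Δ[H] ⊗ₘ Δ[H]) ≫ tensorμ H H H H ≫ (σ ⊗ₘ μ[H])

/-- The morphism `(act ⊗ H) (H ⊗ C) (Δ ⊗ B) : H ⊗ B ⟶ B ⊗ H`; on elements,
`h ⊗ b ↦ (h₁ · b) ⊗ h₂`. -/
def actHat (act : H ⊗ B ⟶ B) : H ⊗ B ⟶ B ⊗ H :=
  Δ[H] ▷ B ≫ (α_ H H B).hom ≫ H ◁ (β_ H B).hom ≫ (α_ H B H).inv ≫ act ▷ H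

/-- `σ : H ⊗ H ⟶ B` is a normalized 2-cocycle with respect to `act`; on elements,
`(h₁ · σ(k₁, l₁)) σ(h₂, k₂ l₂) = σ(h₁, k₁) σ(h₂ k₂, l)` and `σ(h, 1) = σ(1, h) = ε(h) 1`. -/
structure IsTwoCocycle (act : H ⊗ B ⟶ B) (σ : H ⊗ H ⟶ B) : Prop where
  cocycle : (Δ[H] ⊗ₘ cocycleHat σ) ≫ tensorμ H H B H ≫ (act ⊗ₘ σ) ≫ μ[B] =
    (α_ H H H).inv ≫ cocycleHat σ ▷ H ≫ (α_ B H H).hom ≫ B ◁ σ ≫ μ[B]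
  right_one : H ◁ η[H] ≫ σ = (ρ_ H).hom ≫ ε[H] ≫ η[B]
  left_one : η[H] ▷ H ≫ σ = (λ_ H).hom ≫ ε[H] ≫ η[B]

/-- `σ` is invertible for the convolution product of morphisms from the coalgebra `H ⊗ H` (with the
braided tensor product comultiplication) to the algebra `B`. -/
def IsConvolutionInvertible (σ : H ⊗ H ⟶ B) : Prop :=
  IsUnit (M := Conv (H ⊗ H) B) σ

/-- The multiplication of the crossed product `B #_σ H`, whose underlying object is `B ⊗ H`;
on elements, `(b # h) (b' # h') = b (h₁ · b') σ(h₂, h'₁) # h₃ h'₂`. -/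
def crossedMul (act : H ⊗ B ⟶ B) (σ : H ⊗ H ⟶ B) : (B ⊗ H) ⊗ (B ⊗ H) ⟶ B ⊗ H :=
  (α_ B H (B ⊗ H)).hom ≫ B ◁ (α_ H B H).inv ≫
    B ◁ actHat act ▷ H ≫
    B ◁ (α_ B H H).hom ≫ (α_ B B (H ⊗ H)).inv ≫
    (μ[B] ⊗ₘ cocycleHat σ) ≫
    (α_ B B H).inv ≫ μ[B] ▷ H

/-- The unit `η_B ⊗ η_H` of the crossed product. -/
def crossedOne (B H : C) [MonObj B] [HopfObj H] : 𝟙_ C ⟶ B ⊗ H :=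
  (λ_ (𝟙_ C)).inv ≫ (η[B] ⊗ₘ η[H])

/-- `B #_σ H` is a crossed product algebra with invertible 2-cocycle `σ` and weak action `act`:
its multiplication is associative with unit `η_B ⊗ η_H`. -/
structure IsCrossedProductAlgebra (act : H ⊗ B ⟶ B) (σ : H ⊗ H ⟶ B) : Prop where
  weakAction : IsWeakAction act
  twoCocycle : IsTwoCocycle act σ
  invertible : IsConvolutionInvertible σ
  one_mul : crossedOne B H ▷ (B ⊗ H) ≫ crossedMul act σ = (λ_ (B ⊗ H)).hom
  mul_one : (B ⊗ H) ◁ crossedOne B H ≫ crossedMul act σ = (ρ_ (B ⊗ H)).hom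
  mul_assoc : crossedMul act σ ▷ (B ⊗ H) ≫ crossedMul act σ =
    (α_ (B ⊗ H) (B ⊗ H) (B ⊗ H)).hom ≫ (B ⊗ H) ◁ crossedMul act σ ≫ crossedMul act σ

/-- `Φ` is an isomorphism of algebras from the crossed product `B #_σ H` to `A`. -/
structure IsCrossedProductIso {A : C} [MonObj A] (act : H ⊗ B ⟶ B) (σ : H ⊗ H ⟶ B)
    (Φ : B ⊗ H ≅ A) : Prop where
  map_one : crossedOne B H ≫ Φ.hom = η[A]
  map_mul : crossedMul act σ ≫ Φ.hom = (Φ.hom ⊗ₘ Φ.hom) ≫ μ[A]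

/-- Along `Φ : B ⊗ H ≅ A`, the coaction `ψ` corresponds to the coaction `B ⊗ Δ` of the crossed
product and `p` to its canonical morphism `B ⊗ η : B ⟶ B ⊗ H`. -/
structure IsCompatible {A : C} (Φ : B ⊗ H ≅ A) (ψ : A ⟶ A ⊗ H) (p : B ⟶ A) : Prop where
  coaction : Φ.hom ≫ ψ = B ◁ Δ[H] ≫ (α_ B H H).inv ≫ Φ.hom ▷ H
  inclusion : trivialCoaction B H ≫ Φ.hom = p

end CrossedProduct

end BraidedGalois

/-!
For morphisms `f : D ⟶ A` from a comonoid to a monoid, let the twist of `f` be the endomorphism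
`a ⊗ d ↦ a f(d₁) ⊗ d₂` of `A ⊗ D`. Twists are exactly the left `A`-linear, right `D`-colinear
endomorphisms, and they compose like the convolution product; hence `f` is convolution invertible
if and only if its twist is an isomorphism (`isUnit_toConv_iff_isIso_twist`). The whole proof runs
through the cleaving map `j : H ⟶ A`, `j(h) = Φ(1 ⊗ h)`, of an isomorphism `Φ : B ⊗ H ≅ A` that is
`B`-linear and `H`-colinear, so that `Φ(b ⊗ h) = p(b) j(h)`.

For such a `Φ`, the composite of `A ⊗ j` with `q : A ⊗ A ⟶ A ⊗_B A` is always an isomorphism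
(`IsNormalBasis.isIso_cleaving_toTensorOver`), and its composite with `can'` is the twist of `j`. So
`q` splits, and the extension is Galois if and only if `j` is convolution invertible
(`IsNormalBasis.isUnit_cleaving`, `IsNormalBasis.isGalois`).

Given the four conditions, one first normalises `Φ` so that `j(1) = 1`
(`IsNormalBasis.exists_normalised`). Colinearity gives `j(h) p(b) = p(h₁ · b) j(h₂)` and
`j(h) j(k) = p(σ(h₁, k₁)) j(h₂ k₂)` with `h · b` and `σ(h, k)` the `B`-components of the left-hand
sides. Thus `Φ` carries the crossed product multiplication to that of `A`, and the axioms of weak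
actions and cocycles express associativity of products of `j`'s and `p`'s. In the convolution monoid
of morphisms `H ⊗ H ⟶ A`, the second relation writes `σ` as a product of units, and the inverse of
`σ` takes values in the coinvariants by uniqueness of inverses (`IsCoinvariants.isUnit_of_comp`).

Given a crossed product, multiplicativity of the coaction is checked on the generators `p(b)` and
`j(h)` (`crossedMul_comp_star`), the coinvariants form a split equalizer, and the twist of `j`
corresponds along `Φ` to the composite of the twist of `σ` on `B ⊗ (H ⊗ H)` and the twist
`g ⊗ h ↦ g h₁ ⊗ h₂` of the identity of `H` (`twist_cleaving`). The former is invertible because `σ`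
is, and the latter because of the antipode.
-/

namespace BraidedGalois

universe v u

/-! ### External products of morphisms into a monoid -/

/-- The product `f ⋆ g : X ⊗ Y ⟶ A` of morphisms `f : X ⟶ A` and `g : Y ⟶ A` into a monoid; on
elements, `x ⊗ y ↦ f(x) g(y)`. -/
def starMul {C : Type u} [Category.{v} C] [MonoidalCategory C] {A X Y : C} [MonObj A]
    (f : X ⟶ A) (g : Y ⟶ A) : X ⊗ Y ⟶ A :=
  (f ⊗ₘ g) ≫ μ[A]

local infixl:70 " ⋆ " => starMul

section Monoidal

variable {C : Type u} [Category.{v} C] [MonoidalCategory C]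

section Star
variable {A X Y Z X' Y' : C} [MonObj A]

lemma tensorHom_comp_star (u : X' ⟶ X) (v : Y' ⟶ Y) (f : X ⟶ A) (g : Y ⟶ A) :
    (u ⊗ₘ v) ≫ (f ⋆ g) = (u ≫ f) ⋆ (v ≫ g) := by
  simp [starMul]

lemma whiskerRight_comp_star (u : X' ⟶ X) (f : X ⟶ A) (g : Y ⟶ A) :
    u ▷ Y ≫ (f ⋆ g) = (u ≫ f) ⋆ g := by
  rw [← tensorHom_id, tensorHom_comp_star, Category.id_comp]

lemma whiskerLeft_comp_star (v : Y' ⟶ Y) (f : X ⟶ A) (g : Y ⟶ A) :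
    X ◁ v ≫ (f ⋆ g) = f ⋆ (v ≫ g) := by
  rw [← id_tensorHom, tensorHom_comp_star, Category.id_comp]

lemma star_assoc (f : X ⟶ A) (g : Y ⟶ A) (h : Z ⟶ A) :
    f ⋆ g ⋆ h = (α_ X Y Z).hom ≫ (f ⋆ (g ⋆ h)) := by
  have h : f ⋆ g ⋆ h = ((f ⊗ₘ g) ⊗ₘ h) ≫ μ[A] ▷ A ≫ μ[A] := by
    rw [← tensorHom_id, tensorHom_comp_tensorHom_assoc, Category.comp_id, starMul, starMul]
  rw [h, MonObj.mul_assoc, associator_naturality_assoc, ← id_tensorHom,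
    tensorHom_comp_tensorHom_assoc, Category.comp_id, starMul, starMul]

lemma associator_hom_comp_star (f : X ⟶ A) (g : Y ⟶ A) (h : Z ⟶ A) :
    (α_ X Y Z).hom ≫ (f ⋆ (g ⋆ h)) = f ⋆ g ⋆ h := (star_assoc f g h).symm

lemma associator_inv_comp_star (f : X ⟶ A) (g : Y ⟶ A) (h : Z ⟶ A) :
    (α_ X Y Z).inv ≫ (f ⋆ g ⋆ h) = f ⋆ (g ⋆ h) := by
  simp [star_assoc]

lemma one_star (f : X ⟶ A) : η[A] ⋆ f = (λ_ X).hom ≫ f := by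
  simp [starMul, MonoidalCategory.tensorHom_def']

lemma star_one (f : X ⟶ A) : f ⋆ η[A] = (ρ_ X).hom ≫ f := by
  simp [starMul, MonoidalCategory.tensorHom_def]

lemma star_comp {A' : C} [MonObj A'] (f : X ⟶ A) (g : Y ⟶ A) (k : A ⟶ A') [IsMonHom k] :
    (f ⋆ g) ≫ k = (f ≫ k) ⋆ (g ≫ k) := by
  simp [starMul, IsMonHom.mul_hom]

lemma id_star_id : 𝟙 A ⋆ 𝟙 A = μ[A] := by simp [starMul]

end Star

/-- The extension of `w : D ⟶ A ⊗ D'` to a morphism of free left `A`-modules is left `A`-linear. -/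
lemma whiskerLeft_extend_comp_mul {A D D' : C} [MonObj A] (w : D ⟶ A ⊗ D') :
    A ◁ (A ◁ w ≫ (α_ A A D').inv ≫ μ[A] ▷ D') ≫ (α_ A A D').inv ≫ μ[A] ▷ D' =
      ((α_ A A D).inv ≫ μ[A] ▷ D) ≫ A ◁ w ≫ (α_ A A D').inv ≫ μ[A] ▷ D' := by
  have h : A ◁ (α_ A A D').inv ≫ A ◁ μ[A] ▷ D' ≫ (α_ A A D').inv ≫ μ[A] ▷ D' =
      (α_ A A (A ⊗ D')).inv ≫ μ[A] ▷ (A ⊗ D') ≫ (α_ A A D').inv ≫ μ[A] ▷ D' := by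
    calc
      _ = 𝟙 _ ⊗≫ ((α_ A A A).hom ≫ A ◁ μ[A] ≫ μ[A]) ▷ D' := by monoidal
      _ = _ := by rw [← MonObj.mul_assoc]; monoidal
  simp only [MonoidalCategory.whiskerLeft_comp, Category.assoc, h, ← whisker_exchange_assoc]
  simp

/-! ### Convolution and twists -/

section Convolution

variable {A D D' : C} [MonObj A] [ComonObj D] [ComonObj D']

/-- A morphism from a comonoid to a monoid, regarded as an element of the convolution monoid. -/
def toConv (f : D ⟶ A) : Conv D A := f

lemma one_eq_toConv : (1 : Conv D A) = toConv (ε[D] ≫ η[A]) := rfl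

lemma toConv_mul (f g : D ⟶ A) : toConv f * toConv g = toConv (Δ[D] ≫ (f ⋆ g)) := by
  refine (Conv.mul_eq _ _).trans ?_
  simp only [toConv, starMul, MonoidalCategory.tensorHom_def, Category.assoc]
  rfl

lemma isUnit_toConv_iff {f : D ⟶ A} :
    IsUnit (toConv f) ↔
      ∃ g : D ⟶ A, Δ[D] ≫ (f ⋆ g) = ε[D] ≫ η[A] ∧ Δ[D] ≫ (g ⋆ f) = ε[D] ≫ η[A] := by
  rw [isUnit_iff_exists]
  constructor
  · rintro ⟨x, hx⟩
    obtain ⟨g, rfl⟩ : ∃ g : D ⟶ A, toConv g = x := ⟨x, rfl⟩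
    rw [toConv_mul, toConv_mul] at hx
    exact ⟨g, hx⟩
  · rintro ⟨g, hg⟩
    refine ⟨toConv g, ?_⟩
    rw [toConv_mul, toConv_mul]
    exact hg

/-- Precomposition with a morphism of comonoids preserves convolution invertibility. -/
lemma isUnit_toConv_precomp (k : D' ⟶ D) [IsComonHom k] {f : D ⟶ A} (hf : IsUnit (toConv f)) :
    IsUnit (toConv (k ≫ f)) := by
  rw [isUnit_toConv_iff] at hf ⊢
  obtain ⟨g, h₁, h₂⟩ := hf
  refine ⟨k ≫ g, ?_, ?_⟩
  · rw [← tensorHom_comp_star, ← IsComonHom.hom_comul_assoc, h₁, IsComonHom.hom_counit_assoc]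
  · rw [← tensorHom_comp_star, ← IsComonHom.hom_comul_assoc, h₂, IsComonHom.hom_counit_assoc]

/-- The endomorphism `a ⊗ d ↦ a f(d₁) ⊗ d₂` of `A ⊗ D` given by `f : D ⟶ A`. -/
def twist (f : D ⟶ A) : A ⊗ D ⟶ A ⊗ D :=
  A ◁ Δ[D] ≫ (α_ A D D).inv ≫ (𝟙 A ⋆ f) ▷ D

lemma twist_one : twist (ε[D] ≫ η[A]) = 𝟙 (A ⊗ D) := by
  have : 𝟙 A ⋆ (ε[D] ≫ η[A]) = A ◁ ε[D] ≫ (ρ_ A).hom := by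
    rw [← whiskerLeft_comp_star, star_one, Category.comp_id]
  rw [twist, this]
  simp only [comp_whiskerRight, whisker_assoc, Category.assoc, Iso.inv_hom_id_assoc]
  rw [← MonoidalCategory.whiskerLeft_comp_assoc, ComonObj.counit_comul]
  simp

lemma twist_comp_twist (f g : D ⟶ A) :
    twist f ≫ twist g = twist (Δ[D] ≫ (f ⋆ g)) := by
  have h1 : 𝟙 A ⋆ (Δ[D] ≫ (f ⋆ g)) =
      A ◁ Δ[D] ≫ (α_ A D D).inv ≫ (𝟙 A ⋆ f ⋆ g) := by
    rw [associator_inv_comp_star, whiskerLeft_comp_star]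
  have h2 : (𝟙 A ⋆ f) ⋆ g = (𝟙 A ⋆ f) ▷ D ≫ (𝟙 A ⋆ g) := by
    rw [whiskerRight_comp_star, Category.comp_id]
  rw [twist, twist, twist, h1, h2]
  have h3 : A ◁ Δ[D] ≫ (α_ A D D).inv ≫ (A ⊗ D) ◁ Δ[D] ≫ (α_ (A ⊗ D) D D).inv =
      A ◁ Δ[D] ≫ (α_ A D D).inv ≫ (A ◁ Δ[D] ≫ (α_ A D D).inv) ▷ D := by
    calc
      _ = A ◁ (Δ[D] ≫ D ◁ Δ[D]) ⊗≫ 𝟙 _ := by monoidal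
      _ = _ := by rw [ComonObj.comul_assoc]; monoidal
  simp only [Category.assoc, ← whisker_exchange_assoc]
  rw [associator_inv_naturality_left_assoc, ← comp_whiskerRight]
  simp only [← Category.assoc] at h3 ⊢
  rw [h3]
  simp only [comp_whiskerRight, Category.assoc]

lemma twist_eq (f : D ⟶ A) :
    twist f = A ◁ (Δ[D] ≫ f ▷ D) ≫ (α_ A A D).inv ≫ μ[A] ▷ D := by
  rw [twist, ← Category.comp_id f, ← whiskerLeft_comp_star, id_star_id]
  simp

lemma twist_comp_comul (f : D ⟶ A) :
    twist f ≫ A ◁ Δ[D] ≫ (α_ A D D).inv = (A ◁ Δ[D] ≫ (α_ A D D).inv) ≫ twist f ▷ D := by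
  rw [twist]
  simp only [Category.assoc, ← whisker_exchange_assoc, comp_whiskerRight]
  calc
    _ = A ◁ (Δ[D] ≫ D ◁ Δ[D]) ⊗≫ (𝟙 A ⋆ f) ▷ D ▷ D := by monoidal
    _ = _ := by rw [ComonObj.comul_assoc]; monoidal

/-- A left `A`-linear and right `D`-colinear endomorphism of `A ⊗ D` is a twist. -/
lemma eq_twist_of_linear_of_colinear (U : A ⊗ D ⟶ A ⊗ D)
    (hlin : A ◁ U ≫ (α_ A A D).inv ≫ μ[A] ▷ D = ((α_ A A D).inv ≫ μ[A] ▷ D) ≫ U)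
    (hcol : U ≫ A ◁ Δ[D] ≫ (α_ A D D).inv = (A ◁ Δ[D] ≫ (α_ A D D).inv) ≫ U ▷ D) :
    U = twist ((λ_ D).inv ≫ η[A] ▷ D ≫ U ≫ A ◁ ε[D] ≫ (ρ_ A).hom) := by
  set V : D ⟶ A ⊗ D := (λ_ D).inv ≫ η[A] ▷ D ≫ U with hV
  have h1 : U = A ◁ V ≫ (α_ A A D).inv ≫ μ[A] ▷ D := by
    rw [hV]
    simp only [MonoidalCategory.whiskerLeft_comp, Category.assoc, hlin]
    have : A ◁ (λ_ D).inv ≫ A ◁ η[A] ▷ D ≫ (α_ A A D).inv ≫ μ[A] ▷ D = 𝟙 _ := by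
      calc
        _ = 𝟙 _ ⊗≫ (A ◁ η[A] ≫ μ[A]) ▷ D := by monoidal
        _ = _ := by rw [MonObj.mul_one]; monoidal
    rw [reassoc_of% this]
  have h2 : V ≫ A ◁ Δ[D] ≫ (α_ A D D).inv = Δ[D] ≫ V ▷ D := by
    rw [hV, Category.assoc, Category.assoc, hcol]
    simp only [comp_whiskerRight, Category.assoc, ← whisker_exchange_assoc,
      associator_inv_naturality_left_assoc]
    calc
      _ = ((λ_ D).inv ≫ (𝟙_ C) ◁ Δ[D]) ⊗≫ η[A] ▷ D ▷ D ≫ U ▷ D := by monoidal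
      _ = _ := by rw [← leftUnitor_inv_naturality]; monoidal
  have h3 : V = Δ[D] ≫ (V ≫ A ◁ ε[D] ≫ (ρ_ A).hom) ▷ D := by
    rw [comp_whiskerRight, ← reassoc_of% h2]
    calc
      _ = V ≫ A ◁ (λ_ D).inv ⊗≫ 𝟙 _ := by monoidal
      _ = _ := by rw [← ComonObj.counit_comul]; monoidal
  rw [twist_eq]
  have h4 : (λ_ D).inv ≫ η[A] ▷ D ≫ U ≫ A ◁ ε[D] ≫ (ρ_ A).hom =
      V ≫ A ◁ ε[D] ≫ (ρ_ A).hom := by simp [hV]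
  rw [h4, ← h3]
  exact h1

lemma twist_injective {f g : D ⟶ A} (h : twist f = twist g) : f = g := by
  have key (f : D ⟶ A) : f = (λ_ D).inv ≫ η[A] ▷ D ≫ twist f ≫ A ◁ ε[D] ≫ (ρ_ A).hom := by
    have h1 : Δ[D] ≫ f ▷ D ≫ A ◁ ε[D] ≫ (ρ_ A).hom = f := by
      rw [← whisker_exchange_assoc, ComonObj.comul_counit_assoc]
      simp
    have h2 : (λ_ (A ⊗ D)).inv ≫ η[A] ▷ (A ⊗ D) ≫ (α_ A A D).inv ≫ μ[A] ▷ D = 𝟙 _ := by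
      calc
        _ = 𝟙 _ ⊗≫ (η[A] ▷ A ≫ μ[A]) ▷ D := by monoidal
        _ = _ := by rw [MonObj.one_mul]; monoidal
    rw [twist_eq]
    simp only [Category.assoc]
    rw [← whisker_exchange_assoc, ← leftUnitor_inv_naturality_assoc, reassoc_of% h2,
      Category.assoc, h1]
  rw [key f, key g, h]

/-- Convolution invertibility is detected by the twist: the inverse of an invertible twist is again
linear and colinear, hence a twist itself. -/
lemma isUnit_toConv_iff_isIso_twist {f : D ⟶ A} : IsUnit (toConv f) ↔ IsIso (twist f) := by
  rw [isUnit_toConv_iff]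
  constructor
  · rintro ⟨g, h₁, h₂⟩
    refine ⟨twist g, ?_, ?_⟩
    · rw [twist_comp_twist, h₁, twist_one]
    · rw [twist_comp_twist, h₂, twist_one]
  · intro
    have h := eq_twist_of_linear_of_colinear (inv (twist f)) (by
      rw [← cancel_mono (twist f), ← cancel_epi (A ◁ twist f)]
      have := whiskerLeft_extend_comp_mul (Δ[D] ≫ f ▷ D)
      rw [← twist_eq] at this
      simp [this]) (by
      rw [← cancel_epi (twist f), ← cancel_mono (twist f ▷ D)]
      have := twist_comp_comul f
      simp only [Category.assoc] at this
      simp [← this])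
    set g := (λ_ D).inv ≫ η[A] ▷ D ≫ inv (twist f) ≫ A ◁ ε[D] ≫ (ρ_ A).hom
    refine ⟨g, twist_injective ?_, twist_injective ?_⟩
    · rw [← twist_comp_twist, twist_one, ← h, IsIso.hom_inv_id]
    · rw [← twist_comp_twist, twist_one, ← h, IsIso.inv_hom_id]

end Convolution
end Monoidal

/-! ### Products in `A ⊗ H` and morphisms out of a crossed product -/

section Braided

variable {C : Type u} [Category.{v} C] [MonoidalCategory C] [BraidedCategory C]

lemma tensorHom_star_tensorHom {A A' X X' Y Y' : C} [MonObj A] [MonObj A']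
    (f : X ⟶ A) (f' : X' ⟶ A') (g : Y ⟶ A) (g' : Y' ⟶ A') :
    (f ⊗ₘ f') ⋆ (g ⊗ₘ g') = tensorμ X X' Y Y' ≫ ((f ⋆ g) ⊗ₘ (f' ⋆ g')) := by
  rw [starMul, MonObj.tensorObj.mul_def, tensorμ_natural_assoc, tensorHom_comp_tensorHom]
  rfl

variable {A B H : C} [MonObj A] [HopfObj H]

instance : IsMonHom (trivialCoaction A H) := by
  have : IsMonHom η[H] :=
    ⟨by simp, (one_star η[H]).symm⟩
  have : IsMonHom (A ◁ η[H]) := inferInstance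
  have : IsMonHom (ρ_ A).inv := inferInstance
  exact inferInstanceAs (IsMonHom ((ρ_ A).inv ≫ A ◁ η[H]))

/-- The coaction `h ⊗ b ↦ h₁ ⊗ b ⊗ h₂` of `H` on `H ⊗ B`, where `h₂` is braided past `b`. -/
def comulBraid (H B : C) [HopfObj H] : H ⊗ B ⟶ (H ⊗ B) ⊗ H :=
  Δ[H] ▷ B ≫ (α_ H H B).hom ≫ H ◁ (β_ H B).hom ≫ (α_ H B H).inv

lemma actHat_eq (act : H ⊗ B ⟶ B) : actHat act = comulBraid H B ≫ act ▷ H := by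
  simp [actHat, comulBraid]

lemma cocycleHat_eq (σ : H ⊗ H ⟶ B) : cocycleHat σ = Δ[H ⊗ H] ≫ (σ ⊗ₘ μ[H]) := by
  rw [cocycleHat, Comon.tensorObj_comul, Category.assoc]

lemma comulBraid_eq : comulBraid H B =
    (Δ[H] ⊗ₘ (ρ_ B).inv) ≫ tensorμ H H B (𝟙_ C) ≫ (H ⊗ B) ◁ (ρ_ H).hom := by
  simp only [comulBraid, tensorμ, MonoidalCategory.tensorHom_def]
  calc
    _ = Δ[H] ▷ B ⊗≫ H ◁ (β_ H B).hom ⊗≫ 𝟙 _ := by monoidal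
    _ = _ := by monoidal

lemma comulBraid_coassoc :
    comulBraid H B ≫ (H ⊗ B) ◁ Δ[H] ≫ (α_ (H ⊗ B) H H).inv =
      comulBraid H B ≫ comulBraid H B ▷ H := by
  simp only [comulBraid]
  calc
    _ = Δ[H] ▷ B ⊗≫ H ◁ ((β_ H B).hom ≫ B ◁ Δ[H]) ⊗≫ 𝟙 _ := by monoidal
    _ = (Δ[H] ≫ H ◁ Δ[H]) ▷ B ⊗≫ H ◁ (β_ (H ⊗ H) B).hom ⊗≫ 𝟙 _ := by
      rw [← BraidedCategory.braiding_naturality_left]; monoidal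
    _ = (Δ[H] ≫ Δ[H] ▷ H) ▷ B ⊗≫ H ◁ H ◁ (β_ H B).hom ⊗≫ H ◁ (β_ H B).hom ▷ H ⊗≫ 𝟙 _ := by
      rw [ComonObj.comul_assoc, BraidedCategory.braiding_tensor_left_hom]; monoidal
    _ = Δ[H] ▷ B ⊗≫ (Δ[H] ▷ (H ⊗ B) ≫ (H ⊗ H) ◁ (β_ H B).hom) ⊗≫ H ◁ (β_ H B).hom ▷ H ⊗≫ 𝟙 _ := by
      monoidal
    _ = _ := by rw [← whisker_exchange]; monoidal

/-- In `A ⊗ H`, the product of `j(h₁) ⊗ h₂` and `p(b) ⊗ 1`. The factor `h₂` has to be braided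
past `b`. -/
lemma colinear_star_coinvariant (j : H ⟶ A) (p : B ⟶ A) :
    (Δ[H] ≫ j ▷ H) ⋆ (p ≫ trivialCoaction A H) = comulBraid H B ≫ (j ⋆ p) ▷ H := by
  have h : p ≫ trivialCoaction A H = (ρ_ B).inv ≫ (p ⊗ₘ η[H]) := by
    simp [trivialCoaction, MonoidalCategory.tensorHom_def]
  rw [h, ← tensorHom_comp_star, ← tensorHom_id, tensorHom_star_tensorHom, star_one, comulBraid_eq,
    Category.comp_id]
  simp only [Category.assoc, MonoidalCategory.tensorHom_def']

/-- In `A ⊗ H`, the product of `p(b) ⊗ 1` and `f(x) ⊗ u(y)`. Only the unit object is braided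
past `x`, so no braiding remains. -/
lemma coinvariant_star_tensorHom (p : B ⟶ A) {X Y : C} (f : X ⟶ A) (u : Y ⟶ H) :
    (p ≫ trivialCoaction A H) ⋆ (f ⊗ₘ u) = (α_ B X Y).inv ≫ ((p ⋆ f) ⊗ₘ u) := by
  have h : p ≫ trivialCoaction A H = (ρ_ B).inv ≫ (p ⊗ₘ η[H]) := by
    simp [trivialCoaction, MonoidalCategory.tensorHom_def]
  have h' : (ρ_ B).inv ▷ (X ⊗ Y) ≫ tensorμ B (𝟙_ C) X Y ≫ (B ⊗ X) ◁ (λ_ Y).hom =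
      (α_ B X Y).inv := by
    simp only [tensorμ, braiding_tensorUnit_left]
    monoidal
  rw [h, ← whiskerRight_comp_star, tensorHom_star_tensorHom, one_star, ← reassoc_of% h',
    ← id_tensorHom, tensorHom_comp_tensorHom, Category.id_comp]

lemma coinvariant_star_colinear (p : B ⟶ A) (j : H ⟶ A) :
    (p ≫ trivialCoaction A H) ⋆ (Δ[H] ≫ j ▷ H) =
      B ◁ Δ[H] ≫ (α_ B H H).inv ≫ (p ⋆ j) ▷ H := by
  rw [← whiskerLeft_comp_star, ← tensorHom_id, coinvariant_star_tensorHom, tensorHom_id]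

/-- In `A ⊗ H`, the product of `j(h₁) ⊗ h₂` and `j(k₁) ⊗ k₂`. -/
lemma colinear_star_colinear (j : H ⟶ A) :
    (Δ[H] ≫ j ▷ H) ⋆ (Δ[H] ≫ j ▷ H) = Δ[H ⊗ H] ≫ ((j ⋆ j) ⊗ₘ μ[H]) := by
  rw [← tensorHom_comp_star, ← tensorHom_id, tensorHom_star_tensorHom, id_star_id,
    Comon.tensorObj_comul, Category.assoc]

lemma actHat_colinear (act : H ⊗ B ⟶ B) :
    actHat act ≫ B ◁ Δ[H] ≫ (α_ B H H).inv = comulBraid H B ≫ actHat act ▷ H := by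
  have := comulBraid_coassoc (H := H) (B := B)
  rw [actHat_eq, Category.assoc, ← whisker_exchange_assoc, comp_whiskerRight, ← reassoc_of% this]
  simp

lemma cocycleHat_colinear (σ : H ⊗ H ⟶ B) :
    cocycleHat σ ≫ B ◁ Δ[H] ≫ (α_ B H H).inv = Δ[H ⊗ H] ≫ (cocycleHat σ ⊗ₘ μ[H]) := by
  have h1 : μ[H] ≫ Δ[H] = Δ[H ⊗ H] ≫ (μ[H] ⊗ₘ μ[H]) := by
    rw [BimonObj.mul_comul, Comon.tensorObj_comul, Category.assoc]
  calc
    _ = Δ[H ⊗ H] ≫ (σ ⊗ₘ Δ[H ⊗ H]) ≫ (B ◁ (μ[H] ⊗ₘ μ[H])) ≫ (α_ B H H).inv := by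
      rw [cocycleHat_eq, ← id_tensorHom, ← id_tensorHom, tensorHom_comp_tensorHom_assoc,
        Category.assoc, tensorHom_comp_tensorHom_assoc, h1]
    _ = Δ[H ⊗ H] ≫ ((H ⊗ H) ◁ Δ[H ⊗ H]) ≫ (α_ (H ⊗ H) (H ⊗ H) (H ⊗ H)).inv ≫
        ((σ ⊗ₘ μ[H]) ⊗ₘ μ[H]) := by
      rw [← associator_inv_naturality, ← id_tensorHom, ← id_tensorHom,
        tensorHom_comp_tensorHom_assoc, tensorHom_comp_tensorHom_assoc]
      simp
    _ = _ := by
      rw [← ComonObj.comul_assoc_flip_assoc, cocycleHat_eq, ← tensorHom_id,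
        tensorHom_comp_tensorHom, Category.id_comp]

/-- If the products `j(h) p(b)` and `j(h) j(k)` in `A` are computed by `act` and `σ`, then
`b # h ↦ p(b) j(h)` is multiplicative on `B #_σ H`. -/
lemma crossedMul_comp_star [MonObj B] (act : H ⊗ B ⟶ B) (σ : H ⊗ H ⟶ B) (p : B ⟶ A) [IsMonHom p]
    (j : H ⟶ A) (hact : actHat act ≫ (p ⋆ j) = j ⋆ p) (hσ : cocycleHat σ ≫ (p ⋆ j) = j ⋆ j) :
    crossedMul act σ ≫ (p ⋆ j) = (p ⋆ j) ⋆ (p ⋆ j) := by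
  have hp : μ[B] ≫ p = p ⋆ p := by rw [IsMonHom.mul_hom]; rfl
  simp only [crossedMul, Category.assoc, whiskerRight_comp_star, hp, associator_inv_comp_star,
    tensorHom_comp_star, hσ, whiskerLeft_comp_star, associator_hom_comp_star, hact]

end Braided

/-! ### The tensor product `A ⊗_B A` -/

section TensorOver

variable {C : Type u} [Category.{v} C] [MonoidalCategory C] {A B : C} [MonObj A]

lemma actOnLeftFactor_eq (p : B ⟶ A) :
    actOnLeftFactor p = (α_ A B A).inv ≫ (𝟙 A ⋆ p) ▷ A := by
  have : 𝟙 A ⋆ p = A ◁ p ≫ μ[A] := by simp [starMul]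
  simp [actOnLeftFactor, this]

lemma actOnRightFactor_eq (p : B ⟶ A) : actOnRightFactor p = A ◁ (p ⋆ 𝟙 A) := by
  simp [actOnRightFactor, starMul]

lemma toTensorOver_condition [HasCoequalizers C] (p : B ⟶ A) :
    actOnLeftFactor p ≫ toTensorOver p = actOnRightFactor p ≫ toTensorOver p :=
  coequalizer.condition _ _

/-- `q : A ⊗ A ⟶ A ⊗_B A` is a coequalizer of the two actions of `B`. -/
noncomputable def isColimitToTensorOver [HasCoequalizers C] (p : B ⟶ A) :
    IsColimit (Cofork.ofπ (toTensorOver p) (toTensorOver_condition p)) :=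
  coequalizerIsCoequalizer _ _

end TensorOver

/-! ### Normal bases and cleaving maps -/

section NormalBasis

variable {C : Type u} [Category.{v} C] [MonoidalCategory C] [BraidedCategory C]

section Cleaving

variable {A B H : C} [MonObj B] [HopfObj H]

/-- The morphism `h ↦ Φ(1 ⊗ h)`. -/
def cleaving (Φ : B ⊗ H ≅ A) : H ⟶ A := (λ_ H).inv ≫ η[B] ▷ H ≫ Φ.hom

/-- The morphism `A ⟶ B` that corresponds to `B ⊗ ε` along `Φ : B ⊗ H ≅ A`. -/
def projection (Φ : B ⊗ H ≅ A) : A ⟶ B := Φ.inv ≫ B ◁ ε[H] ≫ (ρ_ B).hom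

lemma cleaving_projection (Φ : B ⊗ H ≅ A) : cleaving Φ ≫ projection Φ = ε[H] ≫ η[B] := by
  simp [cleaving, projection, ← whisker_exchange_assoc, unitors_inv_equal]

end Cleaving

variable {A B H : C} [MonObj A] [MonObj B] [HopfObj H]

/-- `Φ : B ⊗ H ≅ A` is left `B`-linear along `p` and right `H`-colinear. -/
structure IsNormalBasis (ψ : A ⟶ A ⊗ H) (p : B ⟶ A) (Φ : B ⊗ H ≅ A) : Prop where
  linear : p ⋆ Φ.hom = (α_ B B H).inv ≫ μ[B] ▷ H ≫ Φ.hom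
  colinear : Φ.hom ≫ ψ = B ◁ Δ[H] ≫ (α_ B H H).inv ≫ Φ.hom ▷ H

lemma hasNormalBasis_iff {ψ : A ⟶ A ⊗ H} {p : B ⟶ A} :
    HasNormalBasis ψ p ↔ ∃ Φ : B ⊗ H ≅ A, IsNormalBasis ψ p Φ := by
  have h (Φ : B ⊗ H ≅ A) : B ◁ Φ.hom ≫ p ▷ A ≫ μ[A] = p ⋆ Φ.hom := by
    rw [starMul, MonoidalCategory.tensorHom_def', Category.assoc]
  simp only [HasNormalBasis, h]
  exact exists_congr fun Φ ↦ ⟨fun h ↦ ⟨h.1, h.2⟩, fun h ↦ ⟨h.1, h.2⟩⟩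

namespace IsNormalBasis

variable {ψ : A ⟶ A ⊗ H} {p : B ⟶ A} {Φ : B ⊗ H ≅ A}

/-- Colinearity recovers the inverse of `Φ` from its `B`-component. -/
lemma coaction_projection (h : IsNormalBasis ψ p Φ) : ψ ≫ projection Φ ▷ H = Φ.inv := by
  rw [← cancel_epi Φ.hom, reassoc_of% h.colinear, ← comp_whiskerRight, projection,
    Iso.hom_inv_id_assoc]
  calc
    _ = B ◁ (Δ[H] ≫ ε[H] ▷ H) ⊗≫ 𝟙 _ := by monoidal
    _ = _ := by rw [ComonObj.counit_comul, Iso.hom_inv_id]; monoidal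

lemma star_inv (h : IsNormalBasis ψ p Φ) {X : C} (f : X ⟶ A) :
    (p ⋆ f) ≫ Φ.inv = B ◁ (f ≫ Φ.inv) ≫ (α_ B B H).inv ≫ μ[B] ▷ H := by
  have : p ⋆ f = B ◁ (f ≫ Φ.inv) ≫ (p ⋆ Φ.hom) := by
    rw [whiskerLeft_comp_star, Category.assoc, Iso.inv_hom_id, Category.comp_id]
  rw [this, h.linear]
  simp

lemma star_projection (h : IsNormalBasis ψ p Φ) {X : C} (f : X ⟶ A) :
    (p ⋆ f) ≫ projection Φ = B ◁ (f ≫ projection Φ) ≫ μ[B] := by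
  rw [projection, reassoc_of% h.star_inv]
  simp only [MonoidalCategory.whiskerLeft_comp, Category.assoc, ← whisker_exchange_assoc]
  congr 2
  monoidal

lemma star_cleaving (h : IsNormalBasis ψ p Φ) : p ⋆ cleaving Φ = Φ.hom := by
  rw [cleaving, ← whiskerLeft_comp_star, ← whiskerLeft_comp_star, h.linear]
  calc
    _ = 𝟙 _ ⊗≫ (B ◁ η[B] ≫ μ[B]) ▷ H ≫ Φ.hom := by monoidal
    _ = _ := by rw [MonObj.mul_one]; monoidal

lemma cleaving_coaction (h : IsNormalBasis ψ p Φ) :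
    cleaving Φ ≫ ψ = Δ[H] ≫ cleaving Φ ▷ H := by
  rw [cleaving, Category.assoc, Category.assoc, h.colinear, ← whisker_exchange_assoc]
  simp

/-- Restricted along the cleaving map, `can'` becomes a twist. -/
lemma cleaving_canPrime (h : IsNormalBasis ψ p Φ) :
    A ◁ cleaving Φ ≫ canPrime ψ = twist (cleaving Φ) := by
  rw [canPrime, ← MonoidalCategory.whiskerLeft_comp_assoc, h.cleaving_coaction, twist_eq]

/-- The composite `A ⊗ H ⟶ A ⊗ A ⟶ A ⊗_B A` is invertible. Its inverse is induced by
`a ⊗ p(b) j(h) ↦ a p(b) ⊗ h`, so that no exactness of the tensor product is needed. -/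
lemma isIso_cleaving_toTensorOver [HasCoequalizers C] [IsMonHom p] (h : IsNormalBasis ψ p Φ) :
    IsIso (A ◁ cleaving Φ ≫ toTensorOver p) := by
  -- `r` sends `a ⊗ p(b) j(h)` to `a p(b) ⊗ h`.
  set r : A ⊗ A ⟶ A ⊗ H := A ◁ Φ.inv ≫ (α_ A B H).inv ≫ (𝟙 A ⋆ p) ▷ H with hr
  have hw : actOnLeftFactor p ≫ r = actOnRightFactor p ≫ r := by
    have h1 : A ◁ μ[B] ≫ (𝟙 A ⋆ p) = (α_ A B B).inv ≫ (𝟙 A ⋆ p) ▷ B ≫ (𝟙 A ⋆ p) := by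
      rw [whiskerLeft_comp_star, whiskerRight_comp_star, IsMonHom.mul_hom, Category.comp_id,
        associator_inv_comp_star]
      rfl
    have h2 := h.star_inv (𝟙 A)
    rw [Category.id_comp] at h2
    rw [actOnLeftFactor_eq, actOnRightFactor_eq, hr, ← MonoidalCategory.whiskerLeft_comp_assoc, h2,
      Category.assoc, ← whisker_exchange_assoc]
    symm
    calc
      _ = A ◁ B ◁ Φ.inv ⊗≫ (A ◁ μ[B] ≫ (𝟙 A ⋆ p)) ▷ H := by monoidal
      _ = _ := by rw [h1]; monoidal
  obtain ⟨d, hd⟩ := Cofork.IsColimit.desc' (isColimitToTensorOver p) r hw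
  change toTensorOver p ≫ d = r at hd
  refine ⟨d, ?_, Cofork.IsColimit.hom_ext (isColimitToTensorOver p) ?_⟩
  · have h1 : A ◁ (λ_ H).inv ≫ A ◁ η[B] ▷ H ≫ (α_ A B H).inv ≫ (𝟙 A ⋆ p) ▷ H = 𝟙 _ := by
      rw [associator_inv_naturality_middle_assoc, ← comp_whiskerRight, whiskerLeft_comp_star,
        IsMonHom.one_hom, star_one]
      monoidal
    rw [Category.assoc, hd, hr, ← MonoidalCategory.whiskerLeft_comp_assoc, cleaving]
    simpa using h1
  · change toTensorOver p ≫ _ = toTensorOver p ≫ _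
    rw [reassoc_of% hd, hr]
    have h1 : (α_ A B H).inv ≫ (𝟙 A ⋆ p) ▷ H ≫ A ◁ cleaving Φ =
        A ◁ B ◁ cleaving Φ ≫ actOnLeftFactor p := by
      rw [actOnLeftFactor_eq, ← whisker_exchange]
      simp
    simp only [Category.assoc, reassoc_of% h1, toTensorOver_condition]
    rw [actOnRightFactor_eq, ← MonoidalCategory.whiskerLeft_comp_assoc,
      ← MonoidalCategory.whiskerLeft_comp_assoc, Category.assoc, whiskerLeft_comp_star,
      Category.comp_id,
      h.star_cleaving]
    simp

/-- By the two lemmas on `A ◁ cleaving Φ`, the twist of the cleaving map is the composite of an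
isomorphism with the isomorphism `can`. -/
lemma isUnit_cleaving [HasCoequalizers C] [IsMonHom p] (h : IsNormalBasis ψ p Φ)
    (hgal : IsGalois ψ p) : IsUnit (toConv (cleaving Φ)) := by
  obtain ⟨can, hcan⟩ := hgal
  have := h.isIso_cleaving_toTensorOver
  rw [isUnit_toConv_iff_isIso_twist, ← h.cleaving_canPrime, ← hcan, ← Category.assoc]
  infer_instance

/-- The quotient morphism splits because its composite with `A ◁ cleaving Φ` is invertible. -/
lemma isSplitEpi_toTensorOver [HasCoequalizers C] [IsMonHom p] (h : IsNormalBasis ψ p Φ) :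
    IsSplitEpi (toTensorOver p) := by
  have := h.isIso_cleaving_toTensorOver
  exact ⟨⟨inv (A ◁ cleaving Φ ≫ toTensorOver p) ≫ A ◁ cleaving Φ, by
    rw [Category.assoc, IsIso.inv_hom_id]⟩⟩

/-- The morphism `can'` factors through `q`, and the factor is invertible because the twist of the
cleaving map is. -/
lemma isGalois [HasCoequalizers C] [IsMonHom p] [IsMonHom ψ] (h : IsNormalBasis ψ p Φ)
    (hp : p ≫ ψ = p ≫ trivialCoaction A H) (hu : IsUnit (toConv (cleaving Φ))) :
    IsGalois ψ p := by
  have hψ : (p ⋆ 𝟙 A) ≫ ψ = B ◁ ψ ≫ (α_ B A H).inv ≫ (p ⋆ 𝟙 A) ▷ H := by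
    rw [star_comp, hp, ← tensorHom_id, ← coinvariant_star_tensorHom, whiskerLeft_comp_star]
    simp
  have hw : actOnLeftFactor p ≫ canPrime ψ = actOnRightFactor p ≫ canPrime ψ := by
    have h1 : A ◁ (p ⋆ 𝟙 A) ≫ μ[A] = (α_ A B A).inv ≫ (𝟙 A ⋆ p) ▷ A ≫ μ[A] := by
      rw [← id_star_id, whiskerLeft_comp_star, whiskerRight_comp_star, Category.comp_id,
        Category.comp_id, associator_inv_comp_star]
    rw [actOnLeftFactor_eq, actOnRightFactor_eq, canPrime,
      ← MonoidalCategory.whiskerLeft_comp_assoc, hψ, Category.assoc, ← whisker_exchange_assoc]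
    symm
    calc
      _ = A ◁ B ◁ ψ ⊗≫ (A ◁ (p ⋆ 𝟙 A) ≫ μ[A]) ▷ H := by monoidal
      _ = _ := by rw [h1]; monoidal
  obtain ⟨d, hd⟩ := Cofork.IsColimit.desc' (isColimitToTensorOver p) (canPrime ψ) hw
  change toTensorOver p ≫ d = canPrime ψ at hd
  change tensorOver p ⟶ A ⊗ H at d
  have hT := isUnit_toConv_iff_isIso_twist.1 hu
  rw [← h.cleaving_canPrime, ← hd, ← Category.assoc] at hT
  have := h.isIso_cleaving_toTensorOver
  have : IsIso d := IsIso.of_isIso_comp_left (A ◁ cleaving Φ ≫ toTensorOver p) d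
  exact ⟨asIso d, hd⟩

end IsNormalBasis

lemma IsCoinvariants.mono {ψ : A ⟶ A ⊗ H} {p : B ⟶ A} (h : IsCoinvariants ψ p) : Mono p := by
  obtain ⟨w, ⟨hl⟩⟩ := h.isEqualizer
  exact mono_of_isLimit_fork hl

lemma IsCoinvariants.exists_lift {ψ : A ⟶ A ⊗ H} {p : B ⟶ A} (h : IsCoinvariants ψ p) {X : C}
    (f : X ⟶ A) (hf : f ≫ ψ = f ≫ trivialCoaction A H) : ∃ g : X ⟶ B, g ≫ p = f := by
  obtain ⟨w, ⟨hl⟩⟩ := h.isEqualizer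
  exact ⟨_, (Fork.IsLimit.lift' hl f hf).2⟩

/-- If `f` is convolution invertible as a morphism into `A`, then it is so as a morphism into the
coinvariants `B`: for the inverse `g`, both `g ≫ ψ` and `g ⊗ 1` are convolution inverses of
`f ≫ p ≫ ψ = (f ≫ p) ⊗ 1`, so they agree and `g` factors through the equalizer `p`. -/
lemma IsCoinvariants.isUnit_of_comp {ψ : A ⟶ A ⊗ H} {p : B ⟶ A} (h : IsCoinvariants ψ p)
    [IsMonHom ψ] {D : C} [ComonObj D] (f : D ⟶ B) (hf : IsUnit (toConv (f ≫ p))) :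
    IsUnit (toConv f) := by
  have := h.isMonHom
  have := h.mono
  obtain ⟨g, h₁, h₂⟩ := isUnit_toConv_iff.1 hf
  have hfψ : (f ≫ p) ≫ ψ = (f ≫ p) ≫ trivialCoaction A H := by
    rw [Category.assoc, Category.assoc, h.isEqualizer.1]
  have hg : g ≫ ψ = g ≫ trivialCoaction A H := by
    have e₁ : toConv (g ≫ ψ) * toConv ((f ≫ p) ≫ ψ) = 1 := by
      rw [toConv_mul, ← star_comp, reassoc_of% h₂, IsMonHom.one_hom, one_eq_toConv]
    have e₂ : toConv ((f ≫ p) ≫ ψ) * toConv (g ≫ trivialCoaction A H) = 1 := by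
      rw [hfψ, toConv_mul, ← star_comp, reassoc_of% h₁, IsMonHom.one_hom, one_eq_toConv]
    exact left_inv_eq_right_inv (M := Conv D (A ⊗ H)) e₁ e₂
  obtain ⟨g, rfl⟩ := h.exists_lift g hg
  refine isUnit_toConv_iff.2 ⟨g, ?_, ?_⟩
  · rw [← cancel_mono p]
    simpa [star_comp] using h₁
  · rw [← cancel_mono p]
    simpa [star_comp] using h₂

end NormalBasis

/-! ### Morphisms of comonoids -/

section ComonHom

variable {C : Type u} [Category.{v} C] [MonoidalCategory C] [BraidedCategory C] (H : C) [HopfObj H]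

instance isComonHom_mul : IsComonHom μ[H] where
  hom_comul := by
    rw [BimonObj.mul_comul, Comon.tensorObj_comul, Category.assoc]
  hom_counit := by simp

attribute [local instance] ComonObj.instTensorUnit

lemma isComonHom_one : IsComonHom η[H] where
  hom_comul := by
    rw [BimonObj.one_comul]
    simp [MonObj.tensorObj.one_def]
  hom_counit := by simp

lemma comul_comp_counit_tensorHom_counit :
    Δ[H] ≫ (ε[H] ⊗ₘ ε[H]) = ε[H] ≫ (λ_ (𝟙_ C)).inv := by
  rw [MonoidalCategory.tensorHom_def, ComonObj.counit_comul_assoc, leftUnitor_inv_naturality]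

/-- `h ⊗ k ↦ ε(k) h` is a morphism of comonoids. -/
lemma isComonHom_fst : IsComonHom (H ◁ ε[H] ≫ (ρ_ H).hom) where
  hom_comul := by
    have h := tensorμ_natural (𝟙 H) (𝟙 H) ε[H] ε[H]
    rw [id_tensorHom_id, id_tensorHom] at h
    have hu := tensor_right_unitality H H
    rw [Comon.tensorObj_comul, ← tensorHom_comp_tensorHom, ← id_tensorHom, Category.assoc,
      Category.assoc, ← reassoc_of% h, ← id_tensorHom, tensorHom_comp_tensorHom_assoc,
      comul_comp_counit_tensorHom_counit, Category.comp_id,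
      ← rightUnitor_naturality, hu, ← tensorHom_id, ← id_tensorHom, tensorHom_comp_tensorHom_assoc,
      tensorHom_comp_tensorHom_assoc]
    simp
  hom_counit := by
    simp [MonoidalCategory.tensorHom_def', unitors_equal]

/-- `h ⊗ k ↦ ε(h) k` is a morphism of comonoids. -/
lemma isComonHom_snd : IsComonHom (ε[H] ▷ H ≫ (λ_ H).hom) where
  hom_comul := by
    have h := tensorμ_natural ε[H] ε[H] (𝟙 H) (𝟙 H)
    rw [id_tensorHom_id, tensorHom_id] at h
    have hu := tensor_left_unitality H H
    rw [Comon.tensorObj_comul, ← tensorHom_comp_tensorHom, ← tensorHom_id, Category.assoc,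
      Category.assoc, ← reassoc_of% h, ← tensorHom_id, tensorHom_comp_tensorHom_assoc,
      comul_comp_counit_tensorHom_counit, Category.comp_id,
      ← leftUnitor_naturality, hu, ← tensorHom_id, ← id_tensorHom, tensorHom_comp_tensorHom_assoc,
      tensorHom_comp_tensorHom_assoc]
    simp
  hom_counit := by
    simp [MonoidalCategory.tensorHom_def]

lemma comul_fst_snd :
    Δ[H ⊗ H] ≫ ((H ◁ ε[H] ≫ (ρ_ H).hom) ⊗ₘ (ε[H] ▷ H ≫ (λ_ H).hom)) = 𝟙 (H ⊗ H) := by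
  have h1 : (Δ[H] ⊗ₘ Δ[H]) ≫ ((H ◁ ε[H]) ⊗ₘ (ε[H] ▷ H)) = ((ρ_ H).inv ⊗ₘ (λ_ H).inv) := by
    rw [tensorHom_comp_tensorHom, ComonObj.comul_counit, ComonObj.counit_comul]
  have h2 : tensorμ H H H H ≫ (H ◁ ε[H] ⊗ₘ ε[H] ▷ H) =
      ((H ◁ ε[H]) ⊗ₘ (ε[H] ▷ H)) ≫ tensorμ H (𝟙_ C) (𝟙_ C) H := by
    have := tensorμ_natural (𝟙 H) ε[H] ε[H] (𝟙 H)
    simpa using this.symm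
  rw [Comon.tensorObj_comul, ← tensorHom_comp_tensorHom, Category.assoc, reassoc_of% h2,
    reassoc_of% h1]
  simp only [tensorμ, braiding_tensorUnit_left, MonoidalCategory.tensorHom_def]
  monoidal

end ComonHom

/-! ### From a normal basis to a crossed product -/

section OfConditions

variable {C : Type u} [Category.{v} C] [MonoidalCategory C] [BraidedCategory C]
variable {A B H : C} [HopfObj H]

/-- The composite in the axioms of weak actions and 2-cocycles, rewritten in terms of `actHat`. -/
lemma comul_tensorμ_tensorHom (act : H ⊗ B ⟶ B) {Y Z : C} (f : H ⊗ Y ⟶ Z) :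
    Δ[H] ▷ (B ⊗ Y) ≫ tensorμ H H B Y ≫ (act ⊗ₘ f) =
      (α_ H B Y).inv ≫ actHat act ▷ Y ≫ (α_ B H Y).hom ≫ B ◁ f := by
  simp only [actHat, tensorμ, MonoidalCategory.tensorHom_def]
  calc
    _ = 𝟙 _ ⊗≫ Δ[H] ▷ B ▷ Y ⊗≫ H ◁ (β_ H B).hom ▷ Y ⊗≫ act ▷ (H ⊗ Y) ≫ B ◁ f := by monoidal
    _ = _ := by monoidal

variable [MonObj A] [MonObj B]

/-- The action `h · b` with `j(h) p(b) = p(h₁ · b) j(h₂)`, where `j` is the cleaving map. -/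
def inducedAction (p : B ⟶ A) (Φ : B ⊗ H ≅ A) : H ⊗ B ⟶ B := (cleaving Φ ⋆ p) ≫ projection Φ

/-- The cocycle with `j(h) j(k) = p(σ(h₁, k₁)) j(h₂ k₂)`, where `j` is the cleaving map. -/
def inducedCocycle (Φ : B ⊗ H ≅ A) : H ⊗ H ⟶ B := (cleaving Φ ⋆ cleaving Φ) ≫ projection Φ

namespace IsNormalBasis

variable {ψ : A ⟶ A ⊗ H} {p : B ⟶ A} {Φ : B ⊗ H ≅ A}

lemma actHat_inducedAction (h : IsNormalBasis ψ p Φ) [IsMonHom ψ]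
    (hp : p ≫ ψ = p ≫ trivialCoaction A H) :
    actHat (inducedAction p Φ) ≫ Φ.hom = cleaving Φ ⋆ p := by
  rw [← Iso.eq_comp_inv, actHat_eq, inducedAction, comp_whiskerRight, ← h.coaction_projection,
    reassoc_of% star_comp, h.cleaving_coaction, hp, colinear_star_coinvariant, Category.assoc]

lemma cocycleHat_inducedCocycle (h : IsNormalBasis ψ p Φ) [IsMonHom ψ] :
    cocycleHat (inducedCocycle Φ) ≫ Φ.hom = cleaving Φ ⋆ cleaving Φ := by
  rw [← Iso.eq_comp_inv, cocycleHat_eq, inducedCocycle, ← h.coaction_projection,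
    reassoc_of% star_comp, h.cleaving_coaction, colinear_star_colinear, Category.assoc,
    ← tensorHom_id, tensorHom_comp_tensorHom, Category.comp_id]

/-- The `B`-component of a product `p(b) j(h) f(y)`. -/
lemma comp_star_projection (h : IsNormalBasis ψ p Φ) {X Y : C} (a : X ⟶ B ⊗ H) (f : Y ⟶ A) :
    ((a ≫ Φ.hom) ⋆ f) ≫ projection Φ =
      a ▷ Y ≫ (α_ B H Y).hom ≫ B ◁ ((cleaving Φ ⋆ f) ≫ projection Φ) ≫ μ[B] := by
  rw [← h.star_projection, reassoc_of% associator_hom_comp_star, h.star_cleaving,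
    reassoc_of% whiskerRight_comp_star]

lemma isWeakAction (h : IsNormalBasis ψ p Φ) [IsMonHom ψ] [IsMonHom p]
    (hp : p ≫ ψ = p ≫ trivialCoaction A H) :
    IsWeakAction (inducedAction p Φ) where
  act_mul := by
    have h1 : μ[B] ≫ p = p ⋆ p := by rw [IsMonHom.mul_hom]; rfl
    have h2 := comul_tensorμ_tensorHom (inducedAction p Φ) (inducedAction p Φ)
    rw [reassoc_of% h2]
    nth_rw 1 [inducedAction]
    rw [reassoc_of% whiskerLeft_comp_star, h1, ← reassoc_of% associator_inv_comp_star,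
      ← h.actHat_inducedAction hp, h.comp_star_projection]
    rfl
  act_one := by
    rw [inducedAction, reassoc_of% whiskerLeft_comp_star, IsMonHom.one_hom, star_one,
      Category.assoc, cleaving_projection]

lemma one_cleaving (hone : crossedOne B H ≫ Φ.hom = η[A]) : η[H] ≫ cleaving Φ = η[A] := by
  rw [← hone, cleaving, crossedOne, MonoidalCategory.tensorHom_def',
    leftUnitor_inv_naturality_assoc]
  simp

lemma isTwoCocycle (h : IsNormalBasis ψ p Φ) [IsMonHom ψ]
    (hp : p ≫ ψ = p ≫ trivialCoaction A H) (hone : crossedOne B H ≫ Φ.hom = η[A]) :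
    IsTwoCocycle (inducedAction p Φ) (inducedCocycle Φ) where
  cocycle := by
    have h2 := comul_tensorμ_tensorHom (inducedAction p Φ) (inducedCocycle Φ)
    rw [MonoidalCategory.tensorHom_def', Category.assoc, reassoc_of% h2]
    -- Both sides are the `B`-component of the product `j(h) j(k) j(l)`.
    have e₁ : (cleaving Φ ⋆ (cleaving Φ ⋆ cleaving Φ)) ≫ projection Φ =
        H ◁ cocycleHat (inducedCocycle Φ) ≫ (α_ H B H).inv ≫ actHat (inducedAction p Φ) ▷ H ≫
          (α_ B H H).hom ≫ B ◁ inducedCocycle Φ ≫ μ[B] := by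
      rw [inducedCocycle, ← h.comp_star_projection, h.actHat_inducedAction hp,
        reassoc_of% associator_inv_comp_star, h.star_cleaving, reassoc_of% whiskerLeft_comp_star,
        ← inducedCocycle, h.cocycleHat_inducedCocycle]
    rw [← e₁, ← reassoc_of% associator_inv_comp_star]
    nth_rw 1 [← h.cocycleHat_inducedCocycle]
    rw [h.comp_star_projection]
    rfl
  right_one := by
    rw [inducedCocycle, reassoc_of% whiskerLeft_comp_star, one_cleaving hone, star_one,
      Category.assoc, cleaving_projection]
  left_one := by
    rw [inducedCocycle, reassoc_of% whiskerRight_comp_star, one_cleaving hone, one_star,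
      Category.assoc, cleaving_projection]

/-- In the convolution monoid of morphisms `H ⊗ H ⟶ A`, the product of `σ` and `j(h k)` is the
product of `ε(k) j(h)` and `ε(h) j(k)`. The last three are precomposites of `j` with morphisms of
comonoids, hence units. -/
lemma isConvolutionInvertible [HasCoequalizers C] (h : IsNormalBasis ψ p Φ) [IsMonHom ψ]
    (hp : IsCoinvariants ψ p) (hgal : IsGalois ψ p) :
    IsConvolutionInvertible (inducedCocycle Φ) := by
  have := hp.isMonHom
  have := isComonHom_fst H
  have := isComonHom_snd H
  have hj := h.isUnit_cleaving hgal
  have hm := isUnit_toConv_precomp μ[H] hj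
  have hf := isUnit_toConv_precomp (H ◁ ε[H] ≫ (ρ_ H).hom) hj
  have hs := isUnit_toConv_precomp (ε[H] ▷ H ≫ (λ_ H).hom) hj
  have key : toConv (inducedCocycle Φ ≫ p) * toConv (μ[H] ≫ cleaving Φ) =
      toConv ((H ◁ ε[H] ≫ (ρ_ H).hom) ≫ cleaving Φ) *
        toConv ((ε[H] ▷ H ≫ (λ_ H).hom) ≫ cleaving Φ) := by
    rw [toConv_mul, toConv_mul, ← tensorHom_comp_star, ← tensorHom_comp_star,
      reassoc_of% (comul_fst_snd H), h.star_cleaving, ← h.cocycleHat_inducedCocycle, cocycleHat_eq,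
      Category.assoc]
  have hu : IsUnit (toConv (inducedCocycle Φ ≫ p)) := by
    rw [← hm.unit_spec, ← Units.eq_mul_inv_iff_mul_eq] at key
    rw [key]
    exact (hf.mul hs).mul (Units.isUnit _)
  exact hp.isUnit_of_comp _ hu

lemma isCrossedProductIso (h : IsNormalBasis ψ p Φ) [IsMonHom ψ] [IsMonHom p]
    (hp : p ≫ ψ = p ≫ trivialCoaction A H) (hone : crossedOne B H ≫ Φ.hom = η[A]) :
    IsCrossedProductIso (inducedAction p Φ) (inducedCocycle Φ) Φ where
  map_one := hone
  map_mul := by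
    have := crossedMul_comp_star (inducedAction p Φ) (inducedCocycle Φ) p (cleaving Φ)
      (by rw [h.star_cleaving, h.actHat_inducedAction hp])
      (by rw [h.star_cleaving, h.cocycleHat_inducedCocycle])
    rw [h.star_cleaving] at this
    exact this

end IsNormalBasis

lemma IsCrossedProductIso.one_mul {act : H ⊗ B ⟶ B} {σ : H ⊗ H ⟶ B} {Φ : B ⊗ H ≅ A}
    (h : IsCrossedProductIso act σ Φ) :
    crossedOne B H ▷ (B ⊗ H) ≫ crossedMul act σ = (λ_ (B ⊗ H)).hom := by
  rw [← cancel_mono Φ.hom, Category.assoc, h.map_mul]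
  change _ ≫ (Φ.hom ⋆ Φ.hom) = _
  rw [whiskerRight_comp_star, h.map_one, one_star]

lemma IsCrossedProductIso.mul_one {act : H ⊗ B ⟶ B} {σ : H ⊗ H ⟶ B} {Φ : B ⊗ H ≅ A}
    (h : IsCrossedProductIso act σ Φ) :
    (B ⊗ H) ◁ crossedOne B H ≫ crossedMul act σ = (ρ_ (B ⊗ H)).hom := by
  rw [← cancel_mono Φ.hom, Category.assoc, h.map_mul]
  change _ ≫ (Φ.hom ⋆ Φ.hom) = _
  rw [whiskerLeft_comp_star, h.map_one, star_one]

lemma IsCrossedProductIso.mul_assoc {act : H ⊗ B ⟶ B} {σ : H ⊗ H ⟶ B} {Φ : B ⊗ H ≅ A}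
    (h : IsCrossedProductIso act σ Φ) :
    crossedMul act σ ▷ (B ⊗ H) ≫ crossedMul act σ =
      (α_ (B ⊗ H) (B ⊗ H) (B ⊗ H)).hom ≫ (B ⊗ H) ◁ crossedMul act σ ≫ crossedMul act σ := by
  have hm : crossedMul act σ ≫ Φ.hom = Φ.hom ⋆ Φ.hom := h.map_mul
  rw [← cancel_mono Φ.hom]
  simp only [Category.assoc, hm, whiskerLeft_comp_star, whiskerRight_comp_star, star_assoc]

lemma one_comul_whiskerRight {X : C} (f : H ⟶ X) :
    η[H] ≫ Δ[H] ≫ f ▷ H = (η[H] ≫ f) ≫ trivialCoaction X H := by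
  rw [Category.assoc, BimonObj.one_comul_assoc, trivialCoaction, MonObj.tensorObj.one_def,
    MonoidalCategory.tensorHom_def]
  simp only [Category.assoc, whisker_exchange, unitors_inv_equal,
    rightUnitor_inv_naturality_assoc]

section Normalise

attribute [local instance] ComonObj.instTensorUnit

/-- A normal basis can be normalised so that `Φ(1 ⊗ 1) = 1`. The element `Φ(1 ⊗ 1)` is coinvariant
and invertible, hence comes from a unit of `B`, and right multiplication by the inverse of this unit
on `B` corrects `Φ`. -/
lemma IsNormalBasis.exists_normalised [HasCoequalizers C] {ψ : A ⟶ A ⊗ H} {p : B ⟶ A}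
    {Φ : B ⊗ H ≅ A} (h : IsNormalBasis ψ p Φ) [IsMonHom ψ] (hp : IsCoinvariants ψ p)
    (hgal : IsGalois ψ p) :
    ∃ Φ' : B ⊗ H ≅ A, IsNormalBasis ψ p Φ' ∧ crossedOne B H ≫ Φ'.hom = η[A] := by
  have := hp.isMonHom
  have := hp.mono
  have := isComonHom_one H
  have hw := isUnit_toConv_precomp η[H] (h.isUnit_cleaving hgal)
  obtain ⟨w, hw'⟩ := hp.exists_lift (η[H] ≫ cleaving Φ) (by
    rw [Category.assoc, h.cleaving_coaction, one_comul_whiskerRight])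
  rw [← hw'] at hw
  obtain ⟨v, h₁, h₂⟩ := isUnit_toConv_iff.1 (hp.isUnit_of_comp w hw)
  simp only [ComonObj.instTensorUnit_comul, ComonObj.instTensorUnit_counit, Category.id_comp,
    Iso.inv_comp_eq] at h₁ h₂
  -- Right multiplications by mutually inverse elements of `B` are mutually inverse.
  have hR {a b : 𝟙_ C ⟶ B} (hab : a ⋆ b = (λ_ (𝟙_ C)).hom ≫ η[B]) :
      ((ρ_ B).inv ≫ (𝟙 B ⋆ a)) ≫ ((ρ_ B).inv ≫ (𝟙 B ⋆ b)) = 𝟙 B := by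
    have h' : 𝟙 B ⋆ ((λ_ (𝟙_ C)).hom ≫ η[B]) = B ◁ (λ_ (𝟙_ C)).hom ≫ (ρ_ B).hom := by
      rw [← whiskerLeft_comp_star, star_one, Category.comp_id]
    rw [Category.assoc, rightUnitor_inv_naturality_assoc, whiskerRight_comp_star, Category.comp_id,
      star_assoc, hab, h']
    monoidal
  let R : B ≅ B := ⟨(ρ_ B).inv ≫ (𝟙 B ⋆ v), (ρ_ B).inv ≫ (𝟙 B ⋆ w), hR h₂, hR h₁⟩
  have hRlin : B ◁ R.hom ≫ μ[B] = μ[B] ≫ R.hom := by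
    change B ◁ ((ρ_ B).inv ≫ (𝟙 B ⋆ v)) ≫ μ[B] = μ[B] ≫ (ρ_ B).inv ≫ (𝟙 B ⋆ v)
    rw [rightUnitor_inv_naturality_assoc, whiskerRight_comp_star, ← id_star_id,
      whiskerLeft_comp_star, Category.comp_id, Category.comp_id, star_assoc,
      ← whiskerLeft_comp_star]
    simp
  refine ⟨whiskerRightIso R H ≪≫ Φ, ⟨?_, ?_⟩, ?_⟩
  · rw [Iso.trans_hom, whiskerRightIso_hom, ← whiskerLeft_comp_star, h.linear,
      associator_inv_naturality_middle_assoc, ← comp_whiskerRight_assoc, hRlin]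
    simp
  · simp [h.colinear, ← whisker_exchange_assoc]
  · have hv : η[B] ≫ R.hom = v := by
      change η[B] ≫ (ρ_ B).inv ≫ (𝟙 B ⋆ v) = v
      rw [rightUnitor_inv_naturality_assoc, whiskerRight_comp_star, Category.comp_id, one_star,
        ← unitors_inv_equal, Iso.inv_hom_id_assoc]
    rw [crossedOne, Iso.trans_hom, whiskerRightIso_hom, ← h.star_cleaving, whiskerRight_comp_star,
      Category.assoc, tensorHom_comp_star, ← hw', reassoc_of% hv, ← star_comp, h₂]
    simp

end Normalise

theorem IsSplitGaloisWithNormalBasis.exists_crossedProduct [HasCoequalizers C]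
    {ψ : A ⟶ A ⊗ H} {p : B ⟶ A} (h : IsSplitGaloisWithNormalBasis ψ p) :
    ∃ (act : H ⊗ B ⟶ B) (σ : H ⊗ H ⟶ B), IsCrossedProductAlgebra act σ ∧
      ∃ Φ : B ⊗ H ≅ A, IsCrossedProductIso act σ Φ ∧ IsCompatible Φ ψ p := by
  have hp := h.coinvariants
  have := hp.isMonHom
  have := h.comoduleAlgebra.isMonHom
  have hw := hp.isEqualizer.1
  obtain ⟨Φ₀, h₀⟩ := hasNormalBasis_iff.1 h.normalBasis
  obtain ⟨Φ, hΦ, hone⟩ := h₀.exists_normalised hp h.galois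
  have hiso := hΦ.isCrossedProductIso hw hone
  refine ⟨inducedAction p Φ, inducedCocycle Φ,
    ⟨hΦ.isWeakAction hw, hΦ.isTwoCocycle hw hone, hΦ.isConvolutionInvertible hp h.galois,
      hiso.one_mul, hiso.mul_one, hiso.mul_assoc⟩, Φ, hiso, hΦ.colinear, ?_⟩
  rw [← hΦ.star_cleaving, trivialCoaction, Category.assoc, whiskerLeft_comp_star,
    IsNormalBasis.one_cleaving hone, star_one, Iso.inv_hom_id_assoc]

end OfConditions

/-! ### From a crossed product to a split Galois extension -/

section OfCrossedProduct

variable {C : Type u} [Category.{v} C] [MonoidalCategory C] [BraidedCategory C]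
variable {A B H : C} [HopfObj H]

/-- On elements, both sides send `h ⊗ k` to `h₁ ⊗ k₁ ⊗ h₂ ⊗ k₂ ⊗ k₃`. -/
lemma comul_comul_right :
    Δ[H ⊗ H] ≫ (H ⊗ H) ◁ (H ◁ Δ[H] ≫ (α_ H H H).inv) =
      H ◁ Δ[H] ≫ (α_ H H H).inv ≫ Δ[H ⊗ H] ▷ H ≫ (α_ (H ⊗ H) (H ⊗ H) H).hom := by
  rw [Comon.tensorObj_comul, MonoidalCategory.tensorHom_def, tensorμ]
  calc
    _ = Δ[H] ▷ H ≫ (H ⊗ H) ◁ Δ[H] ⊗≫ H ◁ ((β_ H H).hom ▷ H ≫ (H ⊗ H) ◁ Δ[H]) ⊗≫ 𝟙 _ := by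
      monoidal
    _ = Δ[H] ▷ H ≫ (H ⊗ H) ◁ (Δ[H] ≫ H ◁ Δ[H]) ⊗≫ H ◁ (β_ H H).hom ▷ (H ⊗ H) ⊗≫ 𝟙 _ := by
      rw [← whisker_exchange]; monoidal
    _ = (Δ[H] ▷ H ≫ (H ⊗ H) ◁ Δ[H]) ⊗≫ H ◁ H ◁ Δ[H] ▷ H ⊗≫ H ◁ (β_ H H).hom ▷ (H ⊗ H) ⊗≫
        𝟙 _ := by
      rw [ComonObj.comul_assoc]; monoidal
    _ = (H ◁ Δ[H] ≫ Δ[H] ▷ (H ⊗ H)) ⊗≫ H ◁ H ◁ Δ[H] ▷ H ⊗≫ H ◁ (β_ H H).hom ▷ (H ⊗ H) ⊗≫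
        𝟙 _ := by
      rw [whisker_exchange]
    _ = _ := by monoidal

/-- On elements, both sides send `h ⊗ k` to `σ(h₁, k₁) ⊗ h₂ k₂ ⊗ k₃`. -/
lemma cocycleHat_twist (σ : H ⊗ H ⟶ B) :
    Δ[H ⊗ H] ≫ σ ▷ (H ⊗ H) ≫ B ◁ twist (𝟙 H) =
      H ◁ Δ[H] ≫ (α_ H H H).inv ≫ cocycleHat σ ▷ H ≫ (α_ B H H).hom := by
  have h := comul_comul_right (H := H)
  simp only [MonoidalCategory.whiskerLeft_comp] at h
  rw [← whisker_exchange, twist, id_star_id, cocycleHat_eq, MonoidalCategory.tensorHom_def']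
  simp only [MonoidalCategory.whiskerLeft_comp, Category.assoc, reassoc_of% h, comp_whiskerRight]
  monoidal

variable [MonObj B]

/-- The product `(1 # h) (b # k)` in `B #_σ H`; on elements, it is
`(h₁ · b) σ(h₂, k₁) # h₃ k₂`. -/
def crossedMulRight (act : H ⊗ B ⟶ B) (σ : H ⊗ H ⟶ B) : H ⊗ (B ⊗ H) ⟶ B ⊗ H :=
  (α_ H B H).inv ≫ actHat act ▷ H ≫ (α_ B H H).hom ≫ B ◁ cocycleHat σ ≫ (α_ B B H).inv ≫ μ[B] ▷ H

lemma crossedMul_eq (act : H ⊗ B ⟶ B) (σ : H ⊗ H ⟶ B) :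
    crossedMul act σ =
      (α_ B H (B ⊗ H)).hom ≫ B ◁ crossedMulRight act σ ≫ (α_ B B H).inv ≫ μ[B] ▷ H := by
  have h : (α_ B B (B ⊗ H)).inv ≫ μ[B] ▷ (B ⊗ H) ≫ (α_ B B H).inv ≫ μ[B] ▷ H =
      B ◁ ((α_ B B H).inv ≫ μ[B] ▷ H) ≫ (α_ B B H).inv ≫ μ[B] ▷ H := by
    calc
      _ = 𝟙 _ ⊗≫ (μ[B] ▷ B ≫ μ[B]) ▷ H := by monoidal
      _ = _ := by rw [MonObj.mul_assoc]; monoidal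
  simp only [crossedMul, crossedMulRight, MonoidalCategory.whiskerLeft_comp, Category.assoc] at h ⊢
  rw [← h, MonoidalCategory.tensorHom_def']
  simp

/-- Left unitality of the crossed product contains `1 · b = b`, which is not an axiom of weak
actions. -/
lemma one_crossedMulRight (act : H ⊗ B ⟶ B) (σ : H ⊗ H ⟶ B)
    (h : crossedOne B H ▷ (B ⊗ H) ≫ crossedMul act σ = (λ_ (B ⊗ H)).hom) :
    η[H] ▷ (B ⊗ H) ≫ crossedMulRight act σ = (λ_ (B ⊗ H)).hom := by
  rw [← h, crossedMul_eq, crossedOne, MonoidalCategory.tensorHom_def']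
  symm
  calc
    _ = 𝟙 _ ⊗≫ η[H] ▷ (B ⊗ H) ⊗≫ (η[B] ▷ (H ⊗ (B ⊗ H)) ≫ B ◁ crossedMulRight act σ) ≫
        (α_ B B H).inv ≫ μ[B] ▷ H := by monoidal
    _ = 𝟙 _ ⊗≫ η[H] ▷ (B ⊗ H) ⊗≫ crossedMulRight act σ ⊗≫ (η[B] ▷ B ≫ μ[B]) ▷ H := by
      rw [← whisker_exchange]; monoidal
    _ = _ := by rw [MonObj.one_mul]; monoidal

lemma one_tensor_crossedMul (act : H ⊗ B ⟶ B) (σ : H ⊗ H ⟶ B) :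
    ((λ_ H).inv ≫ η[B] ▷ H) ▷ (B ⊗ H) ≫ crossedMul act σ = crossedMulRight act σ := by
  rw [crossedMul_eq]
  calc
    _ = 𝟙 _ ⊗≫ (η[B] ▷ (H ⊗ (B ⊗ H)) ≫ B ◁ crossedMulRight act σ) ≫
        (α_ B B H).inv ≫ μ[B] ▷ H := by monoidal
    _ = 𝟙 _ ⊗≫ crossedMulRight act σ ⊗≫ (η[B] ▷ B ≫ μ[B]) ▷ H := by
      rw [← whisker_exchange]; monoidal
    _ = _ := by rw [MonObj.one_mul]; monoidal

lemma trivialCoaction_crossedMul (act : H ⊗ B ⟶ B) (σ : H ⊗ H ⟶ B)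
    (h : crossedOne B H ▷ (B ⊗ H) ≫ crossedMul act σ = (λ_ (B ⊗ H)).hom) :
    trivialCoaction B H ▷ (B ⊗ H) ≫ crossedMul act σ = (α_ B B H).inv ≫ μ[B] ▷ H := by
  rw [crossedMul_eq, trivialCoaction]
  calc
    _ = 𝟙 _ ⊗≫ B ◁ (η[H] ▷ (B ⊗ H) ≫ crossedMulRight act σ) ≫ (α_ B B H).inv ≫ μ[B] ▷ H := by
      monoidal
    _ = _ := by rw [one_crossedMulRight act σ h]; monoidal

/-- `h ↦ h ⊗ 1` is a morphism of comonoids `H ⟶ H ⊗ H`. -/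
lemma isComonHom_trivialCoaction : IsComonHom (trivialCoaction H H) where
  hom_comul := by
    have h := tensorμ_natural (𝟙 H) (𝟙 H) η[H] η[H]
    rw [id_tensorHom_id, id_tensorHom] at h
    have hu : (H ⊗ H) ◁ (λ_ (𝟙_ C)).inv ≫ tensorμ H H (𝟙_ C) (𝟙_ C) =
        (ρ_ (H ⊗ H)).hom ≫ ((ρ_ H).inv ⊗ₘ (ρ_ H).inv) := by
      rw [tensor_right_unitality]
      simp
    have hη : η[H] ≫ Δ[H] = (λ_ (𝟙_ C)).inv ≫ (η[H] ⊗ₘ η[H]) := by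
      rw [BimonObj.one_comul, MonObj.tensorObj.one_def]
    have h₁ : H ◁ η[H] ≫ (Δ[H] ⊗ₘ Δ[H]) =
        Δ[H] ▷ 𝟙_ C ≫ (H ⊗ H) ◁ (λ_ (𝟙_ C)).inv ≫ (H ⊗ H) ◁ (η[H] ⊗ₘ η[H]) := by
      rw [← MonoidalCategory.whiskerLeft_comp, ← hη, ← id_tensorHom, tensorHom_comp_tensorHom,
        Category.id_comp, MonoidalCategory.tensorHom_def]
    rw [Comon.tensorObj_comul, trivialCoaction, Category.assoc, reassoc_of% h₁, h,
      reassoc_of% hu, rightUnitor_naturality_assoc, Iso.inv_hom_id_assoc,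
      tensorHom_comp_tensorHom, id_tensorHom]
  hom_counit := by
    rw [trivialCoaction, Category.assoc, Comon.tensorObj_counit, ← id_tensorHom,
      tensorHom_comp_tensorHom_assoc, BimonObj.one_counit, Category.id_comp, tensorHom_id,
      unitors_equal, rightUnitor_naturality, Iso.inv_hom_id_assoc]

lemma one_cocycleHat {act : H ⊗ B ⟶ B} {σ : H ⊗ H ⟶ B} (hσ : IsTwoCocycle act σ) :
    trivialCoaction H H ≫ cocycleHat σ = (λ_ H).inv ≫ η[B] ▷ H := by
  have := isComonHom_trivialCoaction (H := H)
  rw [cocycleHat_eq, IsComonHom.hom_comul_assoc, tensorHom_comp_tensorHom]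
  have h1 : trivialCoaction H H ≫ σ = ε[H] ≫ η[B] := by
    rw [trivialCoaction, Category.assoc, hσ.right_one, Iso.inv_hom_id_assoc]
  have h2 : trivialCoaction H H ≫ μ[H] = 𝟙 H := by
    rw [trivialCoaction, Category.assoc, MonObj.mul_one, Iso.inv_hom_id]
  rw [h1, h2, tensorHom_id, comp_whiskerRight, ComonObj.counit_comul_assoc]

lemma one_actHat {act : H ⊗ B ⟶ B} (hact : IsWeakAction act) :
    (ρ_ H).inv ≫ H ◁ η[B] ≫ actHat act = (λ_ H).inv ≫ η[B] ▷ H := by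
  have h1 : H ◁ η[B] ≫ comulBraid H B = (ρ_ H).hom ≫ Δ[H] ≫ ((ρ_ H).inv ≫ H ◁ η[B]) ▷ H := by
    rw [comulBraid]
    calc
      _ = (H ◁ η[B] ≫ Δ[H] ▷ B) ⊗≫ H ◁ (β_ H B).hom ⊗≫ 𝟙 _ := by monoidal
      _ = Δ[H] ▷ 𝟙_ C ⊗≫ H ◁ (H ◁ η[B] ≫ (β_ H B).hom) ⊗≫ 𝟙 _ := by
        rw [whisker_exchange]; monoidal
      _ = _ := by
        rw [BraidedCategory.braiding_naturality_right, braiding_tensorUnit_right]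
        monoidal
  rw [actHat_eq, reassoc_of% h1, Iso.inv_hom_id_assoc, ← comp_whiskerRight, Category.assoc,
    hact.act_one, Iso.inv_hom_id_assoc, comp_whiskerRight, ComonObj.counit_comul_assoc]

lemma trivialCoaction_crossedMulRight {act : H ⊗ B ⟶ B} {σ : H ⊗ H ⟶ B}
    (hσ : IsTwoCocycle act σ) :
    H ◁ trivialCoaction B H ≫ crossedMulRight act σ = actHat act := by
  rw [crossedMulRight, trivialCoaction]
  calc
    _ = 𝟙 _ ⊗≫ ((H ⊗ B) ◁ η[H] ≫ actHat act ▷ H) ⊗≫ B ◁ cocycleHat σ ⊗≫ μ[B] ▷ H := by monoidal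
    _ = actHat act ≫ B ◁ (trivialCoaction H H ≫ cocycleHat σ) ⊗≫ μ[B] ▷ H := by
      rw [whisker_exchange, trivialCoaction]; monoidal
    _ = actHat act ⊗≫ (B ◁ η[B] ≫ μ[B]) ▷ H := by rw [one_cocycleHat hσ]; monoidal
    _ = _ := by rw [MonObj.mul_one]; monoidal

lemma one_tensor_crossedMulRight {act : H ⊗ B ⟶ B} (σ : H ⊗ H ⟶ B) (hact : IsWeakAction act) :
    H ◁ ((λ_ H).inv ≫ η[B] ▷ H) ≫ crossedMulRight act σ = cocycleHat σ := by
  rw [crossedMulRight]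
  calc
    _ = ((ρ_ H).inv ≫ H ◁ η[B] ≫ actHat act) ▷ H ⊗≫ B ◁ cocycleHat σ ⊗≫ μ[B] ▷ H := by monoidal
    _ = 𝟙 _ ⊗≫ (η[B] ▷ (H ⊗ H) ≫ B ◁ cocycleHat σ) ⊗≫ μ[B] ▷ H := by
      rw [one_actHat hact]; monoidal
    _ = cocycleHat σ ⊗≫ (η[B] ▷ B ≫ μ[B]) ▷ H := by rw [← whisker_exchange]; monoidal
    _ = _ := by rw [MonObj.one_mul]; monoidal

variable [MonObj A]

/-- Along `Φ : B ⊗ H ≅ A`, the twist of the cleaving map decomposes into the twist of `σ` and the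
twist of the identity of `H`. This reduces its invertibility to that of `σ` and to the antipode. -/
lemma twist_cleaving {Φ : B ⊗ H ≅ A} {p : B ⟶ A} {σ : H ⊗ H ⟶ B}
    (hlin : p ⋆ Φ.hom = (α_ B B H).inv ≫ μ[B] ▷ H ≫ Φ.hom) (hpj : p ⋆ cleaving Φ = Φ.hom)
    (hσ : cocycleHat σ ≫ Φ.hom = cleaving Φ ⋆ cleaving Φ) :
    Φ.hom ▷ H ≫ twist (cleaving Φ) =
      (α_ B H H).hom ≫ twist σ ≫ B ◁ twist (𝟙 H) ≫ (α_ B H H).inv ≫ Φ.hom ▷ H := by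
  have h1 : Φ.hom ⋆ cleaving Φ =
      (α_ B H H).hom ≫ B ◁ cocycleHat σ ≫ (α_ B B H).inv ≫ μ[B] ▷ H ≫ Φ.hom := by
    nth_rw 1 [← hpj]
    rw [star_assoc, ← hσ, ← whiskerLeft_comp_star, hlin]
  have h2 := cocycleHat_twist σ
  rw [twist, ← whisker_exchange_assoc, associator_inv_naturality_left_assoc, ← comp_whiskerRight,
    whiskerRight_comp_star, Category.comp_id, h1, twist_eq]
  have h3 : μ[B] ▷ (H ⊗ H) ≫ B ◁ twist (𝟙 H) = (B ⊗ B) ◁ twist (𝟙 H) ≫ μ[B] ▷ (H ⊗ H) :=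
    (whisker_exchange _ _).symm
  simp only [Category.assoc, reassoc_of% h3]
  symm
  calc
    _ = (α_ B H H).hom ≫ B ◁ (Δ[H ⊗ H] ≫ σ ▷ (H ⊗ H) ≫ B ◁ twist (𝟙 H)) ⊗≫
        μ[B] ▷ (H ⊗ H) ⊗≫ Φ.hom ▷ H := by monoidal
    _ = _ := by rw [h2]; monoidal

namespace IsCrossedProductAlgebra

variable {act : H ⊗ B ⟶ B} {σ : H ⊗ H ⟶ B} {Φ : B ⊗ H ≅ A} {ψ : A ⟶ A ⊗ H} {p : B ⟶ A}

lemma linear (h : IsCrossedProductAlgebra act σ) (hΦ : IsCrossedProductIso act σ Φ)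
    (hc : IsCompatible Φ ψ p) : p ⋆ Φ.hom = (α_ B B H).inv ≫ μ[B] ▷ H ≫ Φ.hom := by
  have hm : crossedMul act σ ≫ Φ.hom = Φ.hom ⋆ Φ.hom := hΦ.map_mul
  rw [← hc.inclusion, ← whiskerRight_comp_star, ← hm,
    reassoc_of% (trivialCoaction_crossedMul act σ h.one_mul)]

lemma isNormalBasis (h : IsCrossedProductAlgebra act σ) (hΦ : IsCrossedProductIso act σ Φ)
    (hc : IsCompatible Φ ψ p) : IsNormalBasis ψ p Φ :=
  ⟨h.linear hΦ hc, hc.coaction⟩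

lemma isMonHom_inclusion (h : IsCrossedProductAlgebra act σ) (hΦ : IsCrossedProductIso act σ Φ)
    (hc : IsCompatible Φ ψ p) : IsMonHom p where
  one_hom := by
    rw [← hc.inclusion, ← hΦ.map_one, trivialCoaction, crossedOne,
      MonoidalCategory.tensorHom_def]
    simp [unitors_inv_equal]
  mul_hom := by
    change _ = p ⋆ p
    have h1 : p ⋆ p = B ◁ trivialCoaction B H ≫ (p ⋆ Φ.hom) := by
      rw [whiskerLeft_comp_star, hc.inclusion]
    rw [h1, h.linear hΦ hc, ← hc.inclusion, trivialCoaction, Category.assoc,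
      rightUnitor_inv_naturality_assoc, ← whisker_exchange_assoc]
    simp

/-- Left multiplication by `j(h)` corresponds to left multiplication by `1 # h`. -/
lemma cleaving_star (hΦ : IsCrossedProductIso act σ Φ) :
    cleaving Φ ⋆ Φ.hom = crossedMulRight act σ ≫ Φ.hom := by
  have hm : crossedMul act σ ≫ Φ.hom = Φ.hom ⋆ Φ.hom := hΦ.map_mul
  rw [← one_tensor_crossedMul, Category.assoc, hm, whiskerRight_comp_star, Category.assoc, cleaving]

lemma actHat_comp (h : IsCrossedProductAlgebra act σ) (hΦ : IsCrossedProductIso act σ Φ)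
    (hc : IsCompatible Φ ψ p) : actHat act ≫ Φ.hom = cleaving Φ ⋆ p := by
  rw [← trivialCoaction_crossedMulRight h.twoCocycle, Category.assoc, ← cleaving_star hΦ,
    whiskerLeft_comp_star, hc.inclusion]

lemma cocycleHat_comp (h : IsCrossedProductAlgebra act σ) (hΦ : IsCrossedProductIso act σ Φ) :
    cocycleHat σ ≫ Φ.hom = cleaving Φ ⋆ cleaving Φ := by
  rw [← one_tensor_crossedMulRight σ h.weakAction, Category.assoc, ← cleaving_star hΦ,
    whiskerLeft_comp_star, Category.assoc, ← cleaving]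

lemma inclusion_coaction (hΦ : IsCrossedProductIso act σ Φ)
    (hc : IsCompatible Φ ψ p) (hb : IsNormalBasis ψ p Φ) :
    p ≫ ψ = p ≫ trivialCoaction A H := by
  have h1 : p = (ρ_ B).inv ≫ B ◁ η[H] ≫ Φ.hom := by
    rw [← hc.inclusion, trivialCoaction, Category.assoc]
  have h2 : η[H] ≫ Δ[H] ≫ cleaving Φ ▷ H = η[A ⊗ H] := by
    rw [one_comul_whiskerRight, IsNormalBasis.one_cleaving hΦ.map_one, IsMonHom.one_hom]
  nth_rw 1 [h1]
  rw [Category.assoc, Category.assoc, hc.coaction, ← hb.star_cleaving, ← coinvariant_star_colinear,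
    whiskerLeft_comp_star, h2, star_one, Iso.inv_hom_id_assoc]

/-- The coaction restricts to `p(b) ⊗ 1` on `B` and to `j(h₁) ⊗ h₂` on `H`, and these satisfy in
`A ⊗ H` the relations that make the induced morphism out of `B #_σ H` multiplicative. -/
lemma isMonHom_coaction (h : IsCrossedProductAlgebra act σ) (hΦ : IsCrossedProductIso act σ Φ)
    (hc : IsCompatible Φ ψ p) : IsMonHom ψ := by
  have hb := h.isNormalBasis hΦ hc
  have hp := h.isMonHom_inclusion hΦ hc
  have hpψ := inclusion_coaction hΦ hc hb
  have hm : crossedMul act σ ≫ Φ.hom = Φ.hom ⋆ Φ.hom := hΦ.map_mul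
  have hΦψ : Φ.hom ≫ ψ = (p ≫ trivialCoaction A H) ⋆ (Δ[H] ≫ cleaving Φ ▷ H) := by
    rw [coinvariant_star_colinear, hb.star_cleaving, hc.coaction]
  have hmul := crossedMul_comp_star act σ (p ≫ trivialCoaction A H) (Δ[H] ≫ cleaving Φ ▷ H)
    (by rw [coinvariant_star_colinear, colinear_star_coinvariant, hb.star_cleaving,
          reassoc_of% (actHat_colinear act), ← comp_whiskerRight, h.actHat_comp hΦ hc])
    (by rw [coinvariant_star_colinear, colinear_star_colinear, hb.star_cleaving,
          reassoc_of% (cocycleHat_colinear σ), ← h.cocycleHat_comp hΦ, ← tensorHom_id,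
          tensorHom_comp_tensorHom, Category.comp_id])
  constructor
  · rw [← IsMonHom.one_hom p, Category.assoc, hpψ, IsMonHom.one_hom_assoc, IsMonHom.one_hom]
  · change μ[A] ≫ ψ = ψ ⋆ ψ
    rw [← hΦψ, ← tensorHom_comp_star, reassoc_of% hm, starMul, Category.assoc] at hmul
    exact (cancel_epi _).1 hmul

lemma isComoduleAlgebra (h : IsCrossedProductAlgebra act σ) (hΦ : IsCrossedProductIso act σ Φ)
    (hc : IsCompatible Φ ψ p) : IsComoduleAlgebra ψ where
  coassoc := by
    rw [← cancel_epi Φ.hom, reassoc_of% hc.coaction, reassoc_of% hc.coaction,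
      ← comp_whiskerRight_assoc, hc.coaction]
    calc
      _ = B ◁ (Δ[H] ≫ Δ[H] ▷ H) ⊗≫ Φ.hom ▷ H ▷ H ⊗≫ 𝟙 _ := by monoidal
      _ = B ◁ (Δ[H] ≫ H ◁ Δ[H]) ⊗≫ Φ.hom ▷ (H ⊗ H) := by rw [ComonObj.comul_assoc]; monoidal
      _ = B ◁ Δ[H] ⊗≫ ((B ⊗ H) ◁ Δ[H] ≫ Φ.hom ▷ (H ⊗ H)) := by monoidal
      _ = _ := by rw [whisker_exchange]; monoidal
  counit := by
    rw [← cancel_epi Φ.hom, reassoc_of% hc.coaction, ← whisker_exchange]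
    calc
      _ = B ◁ (Δ[H] ≫ H ◁ ε[H]) ⊗≫ Φ.hom ▷ 𝟙_ C := by monoidal
      _ = _ := by rw [ComonObj.comul_counit, rightUnitor_inv_naturality]; monoidal
  isMonHom := h.isMonHom_coaction hΦ hc

/-- The equalizer is split by the projection `A ⟶ B`. -/
lemma isCoinvariants (h : IsCrossedProductAlgebra act σ) (hΦ : IsCrossedProductIso act σ Φ)
    (hc : IsCompatible Φ ψ p) : IsCoinvariants ψ p := by
  have hb := h.isNormalBasis hΦ hc
  have hw := inclusion_coaction hΦ hc hb
  have hπ : p ≫ projection Φ = 𝟙 B := by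
    rw [← hc.inclusion, projection, trivialCoaction]
    simp [← MonoidalCategory.whiskerLeft_comp_assoc]
  refine ⟨h.isMonHom_inclusion hΦ hc, hw, ⟨Fork.IsLimit.mk' _ fun s ↦
    ⟨s.ι ≫ projection Φ, ?_, fun {m} hm ↦ ?_⟩⟩⟩
  · change (s.ι ≫ projection Φ) ≫ p = s.ι
    have h1 : trivialCoaction A H ≫ projection Φ ▷ H = projection Φ ≫ trivialCoaction B H := by
      rw [trivialCoaction, trivialCoaction, Category.assoc, whisker_exchange,
        rightUnitor_inv_naturality_assoc]
    rw [Category.assoc, ← hc.inclusion, ← reassoc_of% h1, ← reassoc_of% s.condition,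
      reassoc_of% hb.coaction_projection, Iso.inv_hom_id, Category.comp_id]
  · change m ≫ p = s.ι at hm
    rw [← hm, Category.assoc, hπ]
    exact (Category.comp_id m).symm

lemma isUnit_cleaving (h : IsCrossedProductAlgebra act σ) (hΦ : IsCrossedProductIso act σ Φ)
    (hc : IsCompatible Φ ψ p) : IsUnit (toConv (cleaving Φ)) := by
  have hb := h.isNormalBasis hΦ hc
  have hσ : IsUnit (toConv σ) := h.invertible
  have hid : IsUnit (toConv (𝟙 H)) := isUnit_toConv_iff.2 ⟨HopfObj.antipode, by
    rw [starMul, id_tensorHom, HopfObj.antipode_right], by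
    rw [starMul, tensorHom_id, HopfObj.antipode_left]⟩
  rw [isUnit_toConv_iff_isIso_twist] at hσ hid ⊢
  have key := twist_cleaving hb.linear hb.star_cleaving (h.cocycleHat_comp hΦ)
  have : IsIso (Φ.hom ▷ H ≫ twist (cleaving Φ)) := by
    rw [key]
    infer_instance
  exact IsIso.of_isIso_comp_left (Φ.hom ▷ H) _

theorem isSplitGaloisWithNormalBasis [HasCoequalizers C] (h : IsCrossedProductAlgebra act σ)
    (hΦ : IsCrossedProductIso act σ Φ) (hc : IsCompatible Φ ψ p) :
    IsSplitGaloisWithNormalBasis ψ p := by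
  have hb := h.isNormalBasis hΦ hc
  have := h.isMonHom_inclusion hΦ hc
  have := h.isMonHom_coaction hΦ hc
  exact ⟨h.isComoduleAlgebra hΦ hc, h.isCoinvariants hΦ hc,
    hb.isGalois (inclusion_coaction hΦ hc hb) (h.isUnit_cleaving hΦ hc),
    hb.isSplitEpi_toTensorOver, hasNormalBasis_iff.2 ⟨Φ, hb⟩⟩

end IsCrossedProductAlgebra

end OfCrossedProduct

end BraidedGalois

/-- For algebras `A`, `B` and a Hopf algebra `H` in a braided monoidal category with equalizers and
coequalizers, `A` is a crossed product `B #_σ H` with invertible cocycle iff it carries the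
structure of a split `H`-Galois extension of `B` with normal basis; moreover, for a prescribed
`ψ : A ⟶ A ⊗ H` and `p : B ⟶ A`, the isomorphism `B #_σ H ≅ A` can be chosen to match `ψ` and `p`
with `B ⊗ Δ` and `B ⊗ η` iff `ψ` and `p` themselves satisfy the four conditions. -/
theorem theorem1p3 {C : Type*} [Category* C] [MonoidalCategory C] [BraidedCategory C]
    [HasEqualizers C] [HasCoequalizers C]
    (A B H : C) [MonObj A] [MonObj B] [HopfObj H] :
    ((∃ (act : H ⊗ B ⟶ B) (σ : H ⊗ H ⟶ B), BraidedGalois.IsCrossedProductAlgebra act σ ∧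
        ∃ Φ : B ⊗ H ≅ A, BraidedGalois.IsCrossedProductIso act σ Φ) ↔
      ∃ (ψ : A ⟶ A ⊗ H) (p : B ⟶ A), BraidedGalois.IsSplitGaloisWithNormalBasis ψ p) ∧
    ∀ (ψ : A ⟶ A ⊗ H) (p : B ⟶ A),
      (∃ (act : H ⊗ B ⟶ B) (σ : H ⊗ H ⟶ B), BraidedGalois.IsCrossedProductAlgebra act σ ∧
        ∃ Φ : B ⊗ H ≅ A, BraidedGalois.IsCrossedProductIso act σ Φ ∧
          BraidedGalois.IsCompatible Φ ψ p) ↔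
      BraidedGalois.IsSplitGaloisWithNormalBasis ψ p := by
  refine ⟨⟨?_, ?_⟩, fun ψ p ↦ ⟨?_, fun h ↦ h.exists_crossedProduct⟩⟩
  · rintro ⟨act, σ, h, Φ, hΦ⟩
    refine ⟨Φ.inv ≫ B ◁ Δ[H] ≫ (α_ B H H).inv ≫ Φ.hom ▷ H,
      BraidedGalois.trivialCoaction B H ≫ Φ.hom, h.isSplitGaloisWithNormalBasis hΦ ⟨?_, rfl⟩⟩
    rw [Iso.hom_inv_id_assoc]
  · rintro ⟨ψ, p, h⟩
    obtain ⟨act, σ, hc, Φ, hΦ, -⟩ := h.exists_crossedProduct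
    exact ⟨act, σ, hc, Φ, hΦ⟩
  · rintro ⟨act, σ, h, Φ, hΦ, hc⟩
    exact h.isSplitGaloisWithNormalBasis hΦ hc
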